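/- Let $p\ge 3$ be a prime and let $R$ be a complete regular local ring with perfect residue field $k$ of characteristic $p$ and fraction field of characteristic $0$. Put $d=\dim R$ and $\mathfrak S=W(k)[[u_1,\dots,u_d]]$, and let $\pi:\mathfrak S\to R$ be a surjective ring homomorphism such that $\pi(u_1),\dots,\pi(u_d)$ generate the maximal ideal of $R$. Let $\varphi:\mathfrak S\to\mathfrak S$ be a ring endomorphism that induces the $p$-power map on $\mathfrak S/p\mathfrak S$. Let $\widehat\Omega_{\mathfrak S}=\bigoplus_i\mathfrak S\,du_i$ be the module of $p$-adically completed differentials of $\mathfrak S$, let $d\varphi$ be the $\varphi$-linear endomorphism of $\widehat\Omega_{\mathfrak S}$ induced by $\varphi$ (so $du_i\mapsto d(\varphi(u_i))$), which is divisible by $p$, and let $(d\varphi)_1=p^{-1}d\varphi$. Let $S$ be the $p$-adic completion of the divided power envelope of the ideal $\ker\pi\subset\mathfrak S$ (compatible with the canonical divided powers of $p\mathbf Z_p$), let $\mathrm{Fil}\,S$ be the kernel of the natural map $S\to R$, let $\varphi:S\to S$ be the natural extension of $\varphi$, and let $\varphi_1=p^{-1}\varphi:\mathrm{Fil}\,S\to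 S$; this is well defined, since $S$ has no $p$-torsion and $\varphi(\mathrm{Fil}\,S)\subseteq pS$. Let $\nabla_S:S\to S\otimes_{\mathfrak S}\widehat\Omega_{\mathfrak S}$ be the continuous connection that extends $d:\mathfrak S\to\widehat\Omega_{\mathfrak S}$ and satisfies $\nabla_S(j^{[n]})=j^{[n-1]}\otimes dj$ for $j\in\ker\pi$ and $n\ge1$. An $\underline S$-window is a tuple $\underline M=(M,\mathrm{Fil}\,M,\Phi,\Phi_1)$ where $M$ is a finitely generated projective $S$-module, $\mathrm{Fil}\,M\subseteq M$ is a submodule, and $\Phi:M\to M$ and $\Phi_1:\mathrm{Fil}\,M\to M$ are $\varphi$-linear maps, such that: $M=L\oplus N$ and $\mathrm{Fil}\,M=L\oplus(\mathrm{Fil}\,S)N$ for some submodules $L,N$; $\Phi_1(sm)=\varphi_1(s)\Phi(m)$ for $s\in\mathrm{Fil}\,S$ and $m\in M$; $\Phi(m)=p\,\Phi_1(m)$ for $m\in\mathrm{Fil}\,M$; and $\Phi_1(\mathrm{Fil}\,M)\cup\Phi(M)$ generates $M$. Homomorphisms of windows are the $S$-linear maps that preserve the filtrations and commute with $\Phi$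 and $\Phi_1$; this gives a category $\mathrm{Win}(\underline S)$. Let $\mathrm{Win}(\underline S)^\nabla$ be the category of pairs $(\underline M,\nabla)$ where $\underline M$ is an $\underline S$-window and $\nabla:M\to M\otimes_{\mathfrak S}\widehat\Omega_{\mathfrak S}$ is a connection over $\nabla_S$ (an additive map with $\nabla(sm)=s\nabla(m)+m\otimes\nabla_S(s)$) for which $\Phi$ is horizontal, that is, $\nabla\circ\Phi=(\Phi\otimes d\varphi)\circ\nabla$; its morphisms are the homomorphisms of windows that are compatible with the connections. If $(d\varphi)_1$ is nilpotent on $\widehat\Omega_{\mathfrak S}\otimes_{\mathfrak S}k$, then every $\underline S$-window $\underline M$ has a unique connection $\nabla:M\to M\otimes_{\mathfrak S}\widehat\Omega_{\mathfrak S}$ over $\nabla_S$ for which $\Phi$ is horizontal, and the forgetful functor $\mathrm{Win}(\underline S)^\nabla\to\mathrm{Win}(\underline S)$ is an equivalence of categories. -/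

import Mathlib

open IsLocalRing TensorProduct CategoryTheory

universe u v w

noncomputable section

namespace BreuilWindow

section PDEnvelope

variable (p : ℕ) {A : Type u} [CommRing A] (J : Ideal A) {K : Type w} [CommRing K] [Algebra K A]

/-- The ideal `J + pA`. -/
def pdIdeal : Ideal A := J ⊔ Ideal.span {(p : A)}

/-- The element `p` of the ideal `J + pA`. -/
def pElt : pdIdeal p J :=
  ⟨(p : A), Ideal.mem_sup_right (Ideal.mem_span_singleton_self _)⟩

/-- The relations cutting out the divided power envelope inside the divided power algebra
`Γ_A(J + pA)`: `x^{[1]} = x` for `x ∈ J + pA`, and `p^{[n]} = p ^ n / n!`. -/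
def pdRel : Ideal (DividedPowerAlgebra A (pdIdeal p J)) :=
  Ideal.span
    ({z | ∃ x : pdIdeal p J, z = DividedPowerAlgebra.dp A 1 x - algebraMap A _ (x : A)} ∪
      {z | ∃ (n : ℕ) (c : A), (n.factorial : A) * c = (p : A) ^ n ∧
        z = DividedPowerAlgebra.dp A n (pElt p J) - algebraMap A _ c})

/-- The divided power envelope of `J` in `A` relative to `ℤ_p` with the canonical divided powers
on `pℤ_p`, for a `p`-torsion free `A` in which the integers prime to `p` are invertible.
This is the Berthelot-Ogus construction: the envelopes of `J` and of `J + pA` are the same ring,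
and the latter is the quotient of `Γ_A(J + pA)` by the relations above. -/
def PDEnv : Type u := DividedPowerAlgebra A (pdIdeal p J) ⧸ pdRel p J

instance : CommRing (PDEnv p J) :=
  inferInstanceAs (CommRing (DividedPowerAlgebra A (pdIdeal p J) ⧸ pdRel p J))

/-- The canonical map from the divided power algebra to the divided power envelope. -/
def pdMk : DividedPowerAlgebra A (pdIdeal p J) →+* PDEnv p J := Ideal.Quotient.mk (pdRel p J)

instance : Algebra A (PDEnv p J) := ((pdMk p J).comp (algebraMap A _)).toAlgebra

/-- The divided power `x^{[n]}` of `x ∈ J + pA` in the divided power envelope. -/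
def pdPow (n : ℕ) (x : pdIdeal p J) : PDEnv p J :=
  pdMk p J (DividedPowerAlgebra.dp A n x)

theorem pdPow_zero (x : pdIdeal p J) : pdPow p J 0 x = 1 := by
  simp [pdPow, DividedPowerAlgebra.dp_zero]

theorem pdPow_one (x : pdIdeal p J) : pdPow p J 1 x = algebraMap A (PDEnv p J) (x : A) :=
  Ideal.Quotient.eq.2 (Ideal.subset_span (Or.inl ⟨x, rfl⟩))

theorem pdPow_p (n : ℕ) (c : A) (h : (n.factorial : A) * c = (p : A) ^ n) :
    pdPow p J n (pElt p J) = algebraMap A (PDEnv p J) c :=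
  Ideal.Quotient.eq.2 (Ideal.subset_span (Or.inr ⟨n, c, h, rfl⟩))

theorem pdPow_smul (n : ℕ) (r : A) (x : pdIdeal p J) :
    pdPow p J n (r • x) = algebraMap A (PDEnv p J) r ^ n * pdPow p J n x := by
  simp only [pdPow, DividedPowerAlgebra.dp_smul, Algebra.smul_def, map_mul, map_pow]
  rfl

theorem pdPow_mul (n m : ℕ) (x : pdIdeal p J) :
    pdPow p J n x * pdPow p J m x = (n + m).choose n • pdPow p J (n + m) x := by
  simp only [pdPow, ← map_mul, DividedPowerAlgebra.dp_mul, map_nsmul]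

theorem pdPow_add (n : ℕ) (x y : pdIdeal p J) :
    pdPow p J n (x + y) =
      (Finset.HasAntidiagonal.antidiagonal n).sum fun k => pdPow p J k.1 x * pdPow p J k.2 y := by
  simp only [pdPow, DividedPowerAlgebra.dp_add, map_sum, map_mul]

/-- Ring homomorphisms out of the divided power envelope. -/
def pdLift {B : Type v} [CommRing B] (g : A →+* B) (f : ℕ → pdIdeal p J → B)
    (h0 : ∀ x, f 0 x = 1) (h1 : ∀ x, f 1 x = g x)
    (hp : ∀ (n : ℕ) (c : A), (n.factorial : A) * c = (p : A) ^ n → f n (pElt p J) = g c)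
    (hsmul : ∀ n r x, f n (r • x) = g r ^ n * f n x)
    (hmul : ∀ n m x, f n x * f m x = (n + m).choose n • f (n + m) x)
    (hadd : ∀ n x y, f n (x + y) =
      (Finset.HasAntidiagonal.antidiagonal n).sum fun k => f k.1 x * f k.2 y) :
    PDEnv p J →+* B :=
  letI : Algebra A B := g.toAlgebra
  Ideal.Quotient.lift (pdRel p J)
    (DividedPowerAlgebra.lift' (R := A) (f := fun nm : ℕ × pdIdeal p J => f nm.1 nm.2) h0
      (fun n r x => by
        rw [Algebra.smul_def, map_pow]
        exact hsmul n r x)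
      hmul hadd).toRingHom (by
    intro a ha
    refine (Ideal.span_le (I := RingHom.ker _)).2 ?_ ha
    rintro z (⟨x, rfl⟩ | ⟨n, c, hc, rfl⟩)
    · simp only [SetLike.mem_coe, RingHom.mem_ker, AlgHom.toRingHom_eq_coe, RingHom.coe_coe,
        map_sub, DividedPowerAlgebra.lift'_apply_dp, AlgHom.commutes, h1]
      exact sub_self _
    · simp only [SetLike.mem_coe, RingHom.mem_ker, AlgHom.toRingHom_eq_coe, RingHom.coe_coe,
        map_sub, DividedPowerAlgebra.lift'_apply_dp, AlgHom.commutes, hp n c hc]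
      exact sub_self _)

section

variable {B : Type v} [CommRing B] (g : A →+* B) (f : ℕ → pdIdeal p J → B)
    (h0 : ∀ x, f 0 x = 1) (h1 : ∀ x, f 1 x = g x)
    (hp : ∀ (n : ℕ) (c : A), (n.factorial : A) * c = (p : A) ^ n → f n (pElt p J) = g c)
    (hsmul : ∀ n r x, f n (r • x) = g r ^ n * f n x)
    (hmul : ∀ n m x, f n x * f m x = (n + m).choose n • f (n + m) x)
    (hadd : ∀ n x y, f n (x + y) =
      (Finset.HasAntidiagonal.antidiagonal n).sum fun k => f k.1 x * f k.2 y)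

theorem pdLift_algebraMap (a : A) :
    pdLift p J g f h0 h1 hp hsmul hmul hadd (algebraMap A (PDEnv p J) a) = g a := by
  let _ : Algebra A B := g.toAlgebra
  exact AlgHom.commutes (DividedPowerAlgebra.lift' (R := A)
    (f := fun nm : ℕ × pdIdeal p J => f nm.1 nm.2) h0
      (fun n r x => by
        rw [Algebra.smul_def, map_pow]
        exact hsmul n r x) hmul hadd) a

theorem pdLift_pdPow (n : ℕ) (x : pdIdeal p J) :
    pdLift p J g f h0 h1 hp hsmul hmul hadd (pdPow p J n x) = f n x := by
  let _ : Algebra A B := g.toAlgebra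
  exact DividedPowerAlgebra.lift'_apply_dp (R := A)
    (f := fun nm : ℕ × pdIdeal p J => f nm.1 nm.2) h0
      (fun n r x => by
        rw [Algebra.smul_def, map_pow]
        exact hsmul n r x) hmul hadd n x

end

/-- The endomorphism of the divided power envelope induced by an endomorphism `φ` of `A` that
preserves `J + pA`; it sends `x^{[n]}` to `φ(x)^{[n]}`. -/
def pdPhi (φ : A →+* A) (hφ : ∀ x ∈ pdIdeal p J, φ x ∈ pdIdeal p J) : PDEnv p J →+* PDEnv p J :=
  pdLift p J ((algebraMap A (PDEnv p J)).comp φ) (fun n x => pdPow p J n ⟨φ x, hφ x x.2⟩)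
    (fun x => pdPow_zero p J _) (fun x => pdPow_one p J _)
    (fun n c hc => by
      have h : (⟨φ (pElt p J : A), hφ _ (pElt p J).2⟩ : pdIdeal p J) = pElt p J :=
        Subtype.ext (map_natCast φ p)
      rw [h]
      exact pdPow_p p J n (φ c) (by simpa using congrArg φ hc))
    (fun n r x => by
      have h : (⟨φ ((r • x : pdIdeal p J) : A), hφ _ (r • x).2⟩ : pdIdeal p J) =
          φ r • ⟨φ x, hφ x x.2⟩ := Subtype.ext (map_mul φ r x)
      rw [h]
      exact pdPow_smul p J n (φ r) _)
    (fun n m x => pdPow_mul p J n m _)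
    (fun n x y => by
      have h : (⟨φ ((x + y : pdIdeal p J) : A), hφ _ (x + y).2⟩ : pdIdeal p J) =
          ⟨φ (x : A), hφ x x.2⟩ + ⟨φ (y : A), hφ y y.2⟩ := Subtype.ext (map_add φ (x : A) y)
      rw [h]
      exact pdPow_add p J n _ _)

/-- Auxiliary function for `pdDer`: `x ↦ x^{[n]} + x^{[n-1]} δ(x) ε`. -/
def pdDerAux (δ : Derivation K A A) : ℕ → pdIdeal p J → DualNumber (PDEnv p J)
  | 0, _ => 1
  | n + 1, x => TrivSqZeroExt.inl (pdPow p J (n + 1) x) +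
      TrivSqZeroExt.inr (pdPow p J n x * algebraMap A (PDEnv p J) (δ x))

theorem pdDerAux_zero (δ : Derivation K A A) (x : pdIdeal p J) : pdDerAux p J δ 0 x = 1 := rfl

/-- The ring homomorphism `A → A[ε] → D[ε]`, `a ↦ a + δ(a) ε`. -/
def derHom (δ : Derivation K A A) : A →+* DualNumber (PDEnv p J) where
  toFun a := TrivSqZeroExt.inl (algebraMap A (PDEnv p J) a) +
    TrivSqZeroExt.inr (algebraMap A (PDEnv p J) (δ a))
  map_one' := by simp
  map_zero' := by simp
  map_add' a b := by
    ext
    · simp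
    · simp only [map_add, TrivSqZeroExt.snd_add, TrivSqZeroExt.snd_inl, TrivSqZeroExt.snd_inr,
        zero_add]
  map_mul' a b := by
    ext
    · simp
    · simp only [map_mul, map_add, Derivation.leibniz, smul_eq_mul, TrivSqZeroExt.snd_add,
        TrivSqZeroExt.snd_mul, TrivSqZeroExt.fst_add, TrivSqZeroExt.fst_inl,
        TrivSqZeroExt.fst_inr, TrivSqZeroExt.snd_inl, TrivSqZeroExt.snd_inr, zero_add, add_zero,
        MulOpposite.smul_eq_mul_unop, MulOpposite.unop_op]
      ring

theorem fst_derHom (δ : Derivation K A A) (a : A) :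
    (derHom p J δ a).fst = algebraMap A (PDEnv p J) a := by
  simp [derHom]

theorem snd_derHom (δ : Derivation K A A) (a : A) :
    (derHom p J δ a).snd = algebraMap A (PDEnv p J) (δ a) := by
  change (TrivSqZeroExt.inl _ + TrivSqZeroExt.inr _ : DualNumber (PDEnv p J)).snd = _
  rw [TrivSqZeroExt.snd_add, TrivSqZeroExt.snd_inl, TrivSqZeroExt.snd_inr, zero_add]

theorem pdPow_succ_nsmul (n : ℕ) (x : pdIdeal p J) :
    algebraMap A (PDEnv p J) x * pdPow p J n x = (n + 1 : PDEnv p J) * pdPow p J (n + 1) x := by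
  rw [← pdPow_one, pdPow_mul, add_comm 1 n, Nat.choose_one_right, nsmul_eq_mul]
  push_cast
  rfl

theorem fst_pdDerAux (δ : Derivation K A A) (n : ℕ) (x : pdIdeal p J) :
    (pdDerAux p J δ n x).fst = pdPow p J n x := by
  cases n <;> simp [pdDerAux, pdPow_zero]

theorem snd_pdDerAux_succ (δ : Derivation K A A) (n : ℕ) (x : pdIdeal p J) :
    (pdDerAux p J δ (n + 1) x).snd = pdPow p J n x * algebraMap A (PDEnv p J) (δ x) := by
  simp [pdDerAux]

/-- The derivation of the divided power envelope `D` that extends a derivation `δ` of `A`, as the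
ring homomorphism `D → D[ε]`, `z ↦ z + δ(z) ε`; it satisfies `δ(x^{[n+1]}) = x^{[n]} δ(x)`. -/
def pdDerHom (δ : Derivation K A A)
    (hδ : ∀ (n : ℕ) (c : A), (n.factorial : A) * c = (p : A) ^ n → δ c = 0) :
    PDEnv p J →+* DualNumber (PDEnv p J) :=
  pdLift p J (derHom p J δ) (pdDerAux p J δ) (pdDerAux_zero p J δ)
    (fun x => by
      simp [pdDerAux, derHom, pdPow_zero, pdPow_one])
    (fun n c hc => by
      ext
      · rw [fst_pdDerAux, pdPow_p p J n c hc]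
        simp [derHom]
      · cases n with
        | zero => simp [pdDerAux, derHom, hδ 0 c hc]
        | succ n =>
          have : δ (pElt p J : A) = 0 := by simp [pElt]
          rw [snd_pdDerAux_succ, this]
          simp [derHom, hδ _ c hc])
    (fun n r x => by
      rw [← map_pow]
      ext
      · rw [TrivSqZeroExt.fst_mul, fst_pdDerAux, fst_pdDerAux, fst_derHom, pdPow_smul, map_pow]
      · rw [TrivSqZeroExt.snd_mul, fst_pdDerAux, fst_derHom, snd_derHom]
        cases n with
        | zero => simp [pdDerAux]
        | succ n =>
          have h := pdPow_succ_nsmul p J n x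
          have hd : δ ((r • x : pdIdeal p J) : A) = r * δ x + x * δ r := by
            change δ (r * (x : A)) = _
            simp
          rw [snd_pdDerAux_succ, snd_pdDerAux_succ, pdPow_smul, hd, Derivation.leibniz_pow]
          simp only [smul_eq_mul, nsmul_eq_mul, map_mul, map_add, map_pow, map_natCast,
            MulOpposite.smul_eq_mul_unop, MulOpposite.unop_op, Nat.add_sub_cancel]
          push_cast
          linear_combination algebraMap A (PDEnv p J) r ^ n * algebraMap A (PDEnv p J) (δ r) * h)
    (fun n m x => by
      ext
      · rw [TrivSqZeroExt.fst_mul, TrivSqZeroExt.fst_smul]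
        simp only [fst_pdDerAux, pdPow_mul]
      · rw [TrivSqZeroExt.snd_mul, TrivSqZeroExt.snd_smul, fst_pdDerAux, fst_pdDerAux]
        cases n with
        | zero => cases m <;> simp [pdDerAux, pdPow_zero]
        | succ n =>
          cases m with
          | zero => simp [pdDerAux, pdPow_zero]
          | succ m =>
            rw [show n + 1 + (m + 1) = (n + m + 1) + 1 by ring]
            have h1 := pdPow_mul p J (n + 1) m x
            have h2 := pdPow_mul p J n (m + 1) x
            rw [show n + 1 + m = n + m + 1 by ring] at h1
            rw [show n + (m + 1) = n + m + 1 by ring] at h2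
            simp only [snd_pdDerAux_succ, smul_eq_mul, nsmul_eq_mul, Nat.choose_succ_succ,
              MulOpposite.smul_eq_mul_unop, MulOpposite.unop_op] at *
            push_cast at *
            linear_combination algebraMap A (PDEnv p J) (δ x) * h1 +
              algebraMap A (PDEnv p J) (δ x) * h2)
    (fun n x y => by
      ext
      · rw [TrivSqZeroExt.fst_sum]
        simp only [TrivSqZeroExt.fst_mul, fst_pdDerAux, pdPow_add]
      · rw [TrivSqZeroExt.snd_sum]
        simp only [TrivSqZeroExt.snd_mul, fst_pdDerAux, smul_eq_mul,
          MulOpposite.smul_eq_mul_unop, MulOpposite.unop_op, Finset.sum_add_distrib]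
        cases n with
        | zero => simp [pdDerAux]
        | succ n =>
          have hd : δ ((x + y : pdIdeal p J) : A) = δ x + δ y := map_add δ (x : A) y
          have hz : ∀ z, (pdDerAux p J δ 0 z).snd = 0 := fun _ => rfl
          rw [snd_pdDerAux_succ, pdPow_add, hd,
            Finset.Nat.sum_antidiagonal_succ (f := fun k =>
              (pdDerAux p J δ k.1 x).snd * pdPow p J k.2 y),
            Finset.Nat.sum_antidiagonal_succ' (f := fun k =>
              pdPow p J k.1 x * (pdDerAux p J δ k.2 y).snd)]
          simp only [hz, snd_pdDerAux_succ, mul_zero, zero_mul, zero_add, map_add,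
            mul_add, Finset.sum_mul]
          rw [add_comm]
          congr 1 <;> refine Finset.sum_congr rfl fun k _ => ?_ <;> ring)

/-- The derivation of the divided power envelope that extends a derivation `δ` of `A`. -/
def pdDer (δ : Derivation K A A)
    (hδ : ∀ (n : ℕ) (c : A), (n.factorial : A) * c = (p : A) ^ n → δ c = 0) :
    PDEnv p J →+ PDEnv p J where
  toFun z := (pdDerHom p J δ hδ z).snd
  map_zero' := by simp
  map_add' a b := by simp

theorem pdDer_algebraMap (δ : Derivation K A A)
    (hδ : ∀ (n : ℕ) (c : A), (n.factorial : A) * c = (p : A) ^ n → δ c = 0) (a : A) :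
    pdDer p J δ hδ (algebraMap A _ a) = algebraMap A _ (δ a) := by
  change (pdDerHom p J δ hδ _).snd = _
  rw [pdDerHom, pdLift_algebraMap, snd_derHom]

theorem pdDer_pdPow (δ : Derivation K A A)
    (hδ : ∀ (n : ℕ) (c : A), (n.factorial : A) * c = (p : A) ^ n → δ c = 0)
    (n : ℕ) (x : pdIdeal p J) :
    pdDer p J δ hδ (pdPow p J (n + 1) x) = pdPow p J n x * algebraMap A _ (δ x) := by
  change (pdDerHom p J δ hδ _).snd = _
  rw [pdDerHom, pdLift_pdPow, snd_pdDerAux_succ]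

theorem pdPhi_algebraMap (φ : A →+* A) (hφ : ∀ x ∈ pdIdeal p J, φ x ∈ pdIdeal p J) (a : A) :
    pdPhi p J φ hφ (algebraMap A _ a) = algebraMap A _ (φ a) := by
  rw [pdPhi, pdLift_algebraMap]
  rfl

end PDEnvelope

section Completion

variable (p : ℕ)

/-- The `p`-adic completion of a ring. -/
abbrev PCompl (D : Type u) [CommRing D] : Type u := AdicCompletion (Ideal.span {(p : D)}) D

/-- The map `lim D/p^n → B/p^n` induced by a ring homomorphism `D → B`. -/
def complRingHomAux {D : Type u} {B : Type v} [CommRing D] [CommRing B] (f : D →+* B) (n : ℕ) :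
    PCompl p D →+* B ⧸ Ideal.span {(p : B)} ^ n :=
  (Ideal.quotientMap (Ideal.span {(p : B)} ^ n) f (by
      rw [← Ideal.map_le_iff_le_comap, Ideal.map_pow, Ideal.map_span, Set.image_singleton,
        map_natCast])).comp
    (AdicCompletion.evalₐ (Ideal.span {(p : D)}) n : PCompl p D →+* _)

theorem complRingHomAux_comp {D : Type u} {B : Type v} [CommRing D] [CommRing B] (f : D →+* B)
    {m n : ℕ} (hle : m ≤ n) :
    (Ideal.Quotient.factorPow (Ideal.span {(p : B)}) hle).comp (complRingHomAux p f n) =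
      complRingHomAux p f m := by
  ext x
  have h : AdicCompletion.evalₐ (Ideal.span {(p : D)}) m x =
      Ideal.Quotient.factorPow _ hle (AdicCompletion.evalₐ (Ideal.span {(p : D)}) n x) := by
    obtain ⟨y, rfl⟩ := AdicCompletion.mk_surjective _ _ x
    rw [AdicCompletion.evalₐ_mk, AdicCompletion.evalₐ_mk]
    exact (AdicCompletion.Ideal.mk_eq_mk _ hle y).symm
  simp only [complRingHomAux, RingHom.comp_apply, RingHom.coe_coe, h]
  obtain ⟨z, hz⟩ := Ideal.Quotient.mk_surjective
    (AdicCompletion.evalₐ (Ideal.span {(p : D)}) n x)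
  rw [← hz]
  rfl

/-- The map induced on `p`-adic completions by a ring homomorphism. -/
def complRingHom {D : Type u} {B : Type v} [CommRing D] [CommRing B] (f : D →+* B) :
    PCompl p D →+* PCompl p B :=
  AdicCompletion.liftRingHom _ (complRingHomAux p f) (complRingHomAux_comp p f)

theorem complRingHom_of {D : Type u} {B : Type v} [CommRing D] [CommRing B] (f : D →+* B) (x : D) :
    complRingHom p f (AdicCompletion.of _ _ x) = AdicCompletion.of _ _ (f x) := by
  refine AdicCompletion.ext_evalₐ fun n => ?_
  refine (AdicCompletion.evalₐ_liftRingHom _ _ (complRingHomAux_comp p f) n _).trans ?_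
  rw [complRingHomAux, RingHom.comp_apply, RingHom.coe_coe, AdicCompletion.evalₐ_of,
    AdicCompletion.evalₐ_of]
  exact Ideal.quotientMap_mk

/-- The map induced modulo `p ^ n` by an additive map. -/
def modAddHom {D : Type u} [CommRing D] (f : D →+ D) (n : ℕ) :
    (D ⧸ (Ideal.span {(p : D)} ^ n • (⊤ : Submodule D D))) →+
      (D ⧸ (Ideal.span {(p : D)} ^ n • (⊤ : Submodule D D))) :=
  ((Submodule.Quotient.restrictScalarsEquiv ℤ _).toLinearMap ∘ₗ
    Submodule.mapQ ((Ideal.span {(p : D)} ^ n • (⊤ : Submodule D D)).restrictScalars ℤ)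
      ((Ideal.span {(p : D)} ^ n • (⊤ : Submodule D D)).restrictScalars ℤ) f.toIntLinearMap (by
      intro x hx
      rw [Submodule.restrictScalars_mem, Ideal.span_singleton_pow, smul_eq_mul, Ideal.mul_top,
        Ideal.mem_span_singleton] at hx
      obtain ⟨y, rfl⟩ := hx
      rw [Submodule.mem_comap, Submodule.restrictScalars_mem, Ideal.span_singleton_pow,
        smul_eq_mul, Ideal.mul_top, Ideal.mem_span_singleton]
      refine ⟨f y, ?_⟩
      rw [AddMonoidHom.coe_toIntLinearMap, ← Nat.cast_pow, ← nsmul_eq_mul, map_nsmul,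
        nsmul_eq_mul]) ∘ₗ
    (Submodule.Quotient.restrictScalarsEquiv ℤ _).symm.toLinearMap).toAddMonoidHom

theorem modAddHom_mk {D : Type u} [CommRing D] (f : D →+ D) (n : ℕ) (z : D) :
    modAddHom p f n (Submodule.Quotient.mk z) = Submodule.Quotient.mk (f z) :=
  rfl

theorem transitionMap_modAddHom {D : Type u} [CommRing D] (f : D →+ D) {m n : ℕ} (hmn : m ≤ n)
    (a : D ⧸ (Ideal.span {(p : D)} ^ n • (⊤ : Submodule D D))) :
    AdicCompletion.transitionMap _ D hmn (modAddHom p f n a) =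
      modAddHom p f m (AdicCompletion.transitionMap _ D hmn a) := by
  obtain ⟨z, rfl⟩ := Submodule.Quotient.mk_surjective _ a
  have h : ∀ y : D, AdicCompletion.transitionMap (Ideal.span {(p : D)}) D hmn
      (Submodule.Quotient.mk y) = Submodule.Quotient.mk y := fun y => Submodule.factor_mk _ y
  rw [modAddHom_mk, h, h, modAddHom_mk]

/-- The map induced on `p`-adic completions by an additive map. -/
def complAddHom {D : Type u} [CommRing D] (f : D →+ D) : PCompl p D →+ PCompl p D where
  toFun x := ⟨fun n => modAddHom p f n (x.1 n), fun hmn =>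
    (transitionMap_modAddHom p f hmn _).trans (congrArg (modAddHom p f _) (x.2 hmn))⟩
  map_zero' := AdicCompletion.ext fun n => map_zero (modAddHom p f n)
  map_add' _ _ := AdicCompletion.ext fun n => map_add (modAddHom p f n) _ _

theorem complAddHom_of {D : Type u} [CommRing D] (f : D →+ D) (x : D) :
    complAddHom p f (AdicCompletion.of _ _ x) = AdicCompletion.of _ _ (f x) :=
  AdicCompletion.ext fun n => modAddHom_mk p f n x

end Completion

section Base

variable (p : ℕ) [Fact p.Prime] (k : Type u) [Field k] (d : ℕ)

/-- The power series ring `𝔖 = W(k)[[u_1, …, u_d]]`. -/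
abbrev PS : Type u := MvPowerSeries (Fin d) (WittVector p k)

theorem natCast_witt_ne_zero [CharP k p] {n : ℕ} (hn : n ≠ 0) : (n : WittVector p k) ≠ 0 := by
  intro h
  obtain ⟨e, m, hm, rfl⟩ := Nat.exists_eq_pow_mul_and_not_dvd hn p (Nat.Prime.ne_one Fact.out)
  push_cast at h
  rcases mul_eq_zero.1 h with h | h
  · exact WittVector.p_nonzero p k (eq_zero_of_pow_eq_zero h)
  · refine hm ((CharP.cast_eq_zero_iff k p m).1 ?_)
    simpa using congrArg (WittVector.constantCoeff (p := p) (R := k)) h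

theorem PS.eq_zero_of_natCast_mul [CharP k p] {n : ℕ} (hn : n ≠ 0) (a : PS p k d)
    (h : (n : PS p k d) * a = 0) : a = 0 := by
  refine MvPowerSeries.ext fun m => ?_
  have h1 := congrArg (MvPowerSeries.coeff m) h
  rw [← nsmul_eq_mul, map_nsmul, nsmul_eq_mul, map_zero] at h1
  rw [map_zero]
  exact (mul_eq_zero.1 h1).resolve_left (natCast_witt_ne_zero p k hn)

/-- The partial derivative `∂/∂u_i` of `𝔖`. -/
def partialDer (i : Fin d) : Derivation (WittVector p k) (PS p k d) (PS p k d) :=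
  MvPowerSeries.pderiv (WittVector p k) i

theorem partialDer_pow_div_factorial [CharP k p] (i : Fin d) (n : ℕ) (c : PS p k d)
    (hc : (n.factorial : PS p k d) * c = (p : PS p k d) ^ n) : partialDer p k d i c = 0 := by
  refine PS.eq_zero_of_natCast_mul p k d n.factorial_ne_zero _ ?_
  have h := congrArg (partialDer p k d i) hc
  rw [← nsmul_eq_mul, map_nsmul, nsmul_eq_mul, ← Nat.cast_pow, Derivation.map_natCast] at h
  exact h

/-- The module `Ω̂_𝔖` of continuous (that is, `p`-adically completed) differentials of `𝔖`, for a
perfect field `k`: the free module with basis `du_1, …, du_d`, where `du_i` is the `i`-th unit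
vector. -/
abbrev Omega : Type u := Fin d → PS p k d

/-- The universal derivation `d : 𝔖 → Ω̂_𝔖`, `f ↦ ∑ (∂f/∂u_i) du_i`. -/
def univD : Derivation (WittVector p k) (PS p k d) (Omega p k d) where
  toFun a := fun i => partialDer p k d i a
  map_add' a b := by ext1 i; simp
  map_smul' r a := by ext1 i; simp
  map_one_eq_zero' := by ext1 i; simp
  leibniz' a b := by ext1 i; simp

variable {p k d}

/-- `φ` is a lift of Frobenius: it induces the `p`-power map modulo `p`. -/
def IsFrobeniusLift (φ : PS p k d →+* PS p k d) : Prop :=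
  ∀ a, φ a - a ^ p ∈ Ideal.span {(p : PS p k d)}

/-- The `φ`-linear map `dφ : Ω̂_𝔖 → Ω̂_𝔖`, with `du_i ↦ d(φ(u_i))`. -/
def dPhi (φ : PS p k d →+* PS p k d) : Omega p k d →ₛₗ[φ] Omega p k d where
  toFun ω := ∑ i, φ (ω i) • univD p k d (φ (MvPowerSeries.X i))
  map_add' ω η := by simp [add_smul, Finset.sum_add_distrib]
  map_smul' r ω := by simp [mul_smul, Finset.smul_sum]

theorem exists_univD_eq {φ : PS p k d →+* PS p k d} (hφ : IsFrobeniusLift φ) (a : PS p k d) :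
    ∃ η : Omega p k d, (p : PS p k d) • η = univD p k d (φ a) := by
  obtain ⟨b, hb⟩ := Ideal.mem_span_singleton.1 (hφ a)
  refine ⟨a ^ (p - 1) • univD p k d a + univD p k d b, ?_⟩
  have h : φ a = a ^ p + (p : PS p k d) * b := by rw [← hb]; ring
  rw [h, map_add, Derivation.leibniz_pow, Derivation.leibniz, Derivation.map_natCast, smul_zero,
    add_zero, smul_add, ← Nat.cast_smul_eq_nsmul (PS p k d)]

/-- The `φ`-linear map `(dφ)_1 = p⁻¹ dφ` of `Ω̂_𝔖`. -/
def dPhiOne (φ : PS p k d →+* PS p k d) (hφ : IsFrobeniusLift φ) :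
    Omega p k d →ₛₗ[φ] Omega p k d where
  toFun ω := ∑ i, φ (ω i) • (exists_univD_eq hφ (MvPowerSeries.X i)).choose
  map_add' ω η := by simp [add_smul, Finset.sum_add_distrib]
  map_smul' r ω := by simp [mul_smul, Finset.smul_sum]

theorem p_smul_dPhiOne (φ : PS p k d →+* PS p k d) (hφ : IsFrobeniusLift φ) (ω : Omega p k d) :
    (p : PS p k d) • dPhiOne φ hφ ω = dPhi φ ω := by
  simp only [dPhiOne, dPhi, LinearMap.coe_mk, AddHom.coe_mk]
  rw [Finset.smul_sum]
  refine Finset.sum_congr rfl fun i _ => ?_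
  rw [smul_comm, (exists_univD_eq hφ (MvPowerSeries.X i)).choose_spec]

variable (p k d) in
/-- The augmentation `𝔖 → k`; its kernel is the maximal ideal of `𝔖`. -/
def toResidue : PS p k d →+* k := WittVector.constantCoeff.comp MvPowerSeries.constantCoeff

/-- `(dφ)_1` is nilpotent on `Ω̂_𝔖 ⊗ k = Ω̂_𝔖 / 𝔪 Ω̂_𝔖`: some iterate is zero there. -/
def DPhiOneNilpotent (φ : PS p k d →+* PS p k d) (hφ : IsFrobeniusLift φ) : Prop :=
  ∃ n : ℕ, ∀ ω : Omega p k d,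
    (dPhiOne φ hφ)^[n] ω ∈ RingHom.ker (toResidue p k d) • (⊤ : Submodule (PS p k d) (Omega p k d))

theorem IsFrobeniusLift.map_pdIdeal {φ : PS p k d →+* PS p k d} (hφ : IsFrobeniusLift φ)
    (J : Ideal (PS p k d)) : ∀ x ∈ pdIdeal p J, φ x ∈ pdIdeal p J := by
  intro x hx
  have h1 : φ x - x ^ p ∈ pdIdeal p J := Ideal.mem_sup_right (hφ x)
  have h2 : x ^ p ∈ pdIdeal p J :=
    Ideal.pow_mem_of_mem _ hx p (Nat.Prime.pos Fact.out)
  simpa using add_mem h1 h2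

/-- The ring `S`: the `p`-adic completion of the divided power envelope of `J` in `𝔖`. -/
abbrev BS (J : Ideal (PS p k d)) : Type u := PCompl p (PDEnv p J)

/-- The natural extension of `φ` to `S`. -/
def phiS (J : Ideal (PS p k d)) (φ : PS p k d →+* PS p k d) (hφ : IsFrobeniusLift φ) :
    BS J →+* BS J :=
  complRingHom p (pdPhi p J φ (hφ.map_pdIdeal J))

theorem phiS_algebraMap (J : Ideal (PS p k d)) (φ : PS p k d →+* PS p k d)
    (hφ : IsFrobeniusLift φ) (a : PS p k d) :
    phiS J φ hφ (algebraMap _ (BS J) a) = algebraMap _ (BS J) (φ a) := by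
  have h : ∀ b : PS p k d, algebraMap _ (BS J) b =
    AdicCompletion.of (Ideal.span {(p : PDEnv p J)}) (PDEnv p J) (algebraMap _ (PDEnv p J) b) :=
    fun _ => rfl
  rw [h, h, phiS, complRingHom_of, pdPhi_algebraMap]

/-- The module `S ⊗_𝔖 Ω̂_𝔖`. -/
abbrev OmegaS (J : Ideal (PS p k d)) : Type u := BS J ⊗[PS p k d] Omega p k d

/-- The continuous connection `∇_S : S → S ⊗_𝔖 Ω̂_𝔖`, which extends `d : 𝔖 → Ω̂_𝔖` and satisfies
`∇_S(j^{[n]}) = j^{[n-1]} ⊗ dj`. -/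
def nablaS [CharP k p] (J : Ideal (PS p k d)) : BS J →+ OmegaS J :=
  ∑ i : Fin d, ((TensorProduct.mk (PS p k d) (BS J) (Omega p k d)).flip
      (Pi.single i 1)).toAddMonoidHom.comp
    (complAddHom p (pdDer p J (partialDer p k d i) (partialDer_pow_div_factorial p k d i)))

/-- The map `φ ⊗ dφ` on `S ⊗_𝔖 Ω̂_𝔖`, which is linear over `φ : S → S`. -/
def dPhiS (J : Ideal (PS p k d)) (φ : PS p k d →+* PS p k d) (hφ : IsFrobeniusLift φ) :
    OmegaS J →ₛₗ[phiS J φ hφ] OmegaS J where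
  toFun := TensorProduct.map (σ₁₂ := φ)
    ({ toFun := phiS J φ hφ
       map_add' := map_add _
       map_smul' := fun a s => by
        rw [Algebra.smul_def, map_mul, phiS_algebraMap, Algebra.smul_def] } :
      BS J →ₛₗ[φ] BS J) (dPhi φ)
  map_add' := map_add _
  map_smul' s t := by
    induction t using TensorProduct.induction_on with
    | zero => simp
    | add x y hx hy => simp only [smul_add, map_add, hx, hy]
    | tmul x y =>
      rw [TensorProduct.smul_tmul', TensorProduct.map_tmul, TensorProduct.map_tmul,
        TensorProduct.smul_tmul']
      simp

end Base

section Residue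

variable (p : ℕ) [Fact p.Prime] {A : Type u} [CommRing A] {R : Type v} [CommRing R]

theorem exists_factorial_mul_eq_pow [IsLocalRing R] [CharP (ResidueField R) p] (n : ℕ) :
    ∃ c : R, (n.factorial : R) * c = (p : R) ^ n := by
  obtain ⟨e, m, hm, h⟩ := Nat.exists_eq_pow_mul_and_not_dvd n.factorial_ne_zero p
    (Nat.Prime.ne_one Fact.out)
  have hu : IsUnit (m : R) := by
    rw [← IsLocalRing.notMem_maximalIdeal, ← IsLocalRing.residue_eq_zero_iff, map_natCast,
      CharP.cast_eq_zero_iff (ResidueField R) p]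
    exact hm
  have he : e ≤ n := by
    refine le_trans ?_ (padicValNat_factorial_le p n)
    rw [← padicValNat_dvd_iff_le n.factorial_ne_zero, h]
    exact dvd_mul_right _ _
  obtain ⟨v, hv⟩ := hu.exists_right_inv
  refine ⟨v * (p : R) ^ (n - e), ?_⟩
  rw [h]
  push_cast
  calc (p : R) ^ e * m * (v * (p : R) ^ (n - e))
      = (m * v) * ((p : R) ^ e * (p : R) ^ (n - e)) := by ring
    _ = _ := by rw [hv, one_mul, ← pow_add, Nat.add_sub_cancel' he]

/-- For `π : A → R` and `x ∈ ker π + pA`, the element `π(x) ^ n / n!` exists in `R`. -/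
theorem exists_factorial_mul_eq_map_pow [IsLocalRing R] [CharP (ResidueField R) p]
    (π : A →+* R) (n : ℕ) (x : pdIdeal p (RingHom.ker π)) :
    ∃ c : R, (n.factorial : R) * c = π x ^ n := by
  obtain ⟨y, hy, z, hz, hyz⟩ := Submodule.mem_sup.1 x.2
  obtain ⟨t, rfl⟩ := Ideal.mem_span_singleton.1 hz
  obtain ⟨c, hc⟩ := exists_factorial_mul_eq_pow p (R := R) n
  refine ⟨c * π t ^ n, ?_⟩
  rw [← hyz, map_add, RingHom.mem_ker.1 hy, zero_add, map_mul, map_natCast, mul_pow, ← hc,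
    mul_assoc]

/-- The element `π(x) ^ n / n!` of `R`, for `x ∈ ker π + pA`. -/
def mapDivPow [IsLocalRing R] [CharP (ResidueField R) p] (π : A →+* R) (n : ℕ)
    (x : pdIdeal p (RingHom.ker π)) : R :=
  (exists_factorial_mul_eq_map_pow p π n x).choose

theorem factorial_mul_mapDivPow [IsLocalRing R] [CharP (ResidueField R) p] (π : A →+* R) (n : ℕ)
    (x : pdIdeal p (RingHom.ker π)) :
    (n.factorial : R) * mapDivPow p π n x = π x ^ n :=
  (exists_factorial_mul_eq_map_pow p π n x).choose_spec

variable [IsDomain R] [CharZero R]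

theorem factorial_mul_cancel {n : ℕ} {a b : R}
    (h : (n.factorial : R) * a = (n.factorial : R) * b) : a = b :=
  mul_left_cancel₀ (Nat.cast_ne_zero.2 n.factorial_ne_zero) h

variable [IsLocalRing R] [CharP (ResidueField R) p]

/-- The natural map from the divided power envelope of `ker π` to `R`; it extends `π` and sends
`x^{[n]}` to `π(x) ^ n / n!`. -/
def pdToR (π : A →+* R) : PDEnv p (RingHom.ker π) →+* R :=
  pdLift p (RingHom.ker π) π (mapDivPow p π)
    (fun x => by simpa using factorial_mul_mapDivPow p π 0 x)
    (fun x => by simpa using factorial_mul_mapDivPow p π 1 x)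
    (fun n c hc => by
      refine factorial_mul_cancel (n := n) ?_
      rw [factorial_mul_mapDivPow, ← map_natCast π, ← map_mul, hc, map_pow]
      rfl)
    (fun n r x => by
      refine factorial_mul_cancel (n := n) ?_
      rw [factorial_mul_mapDivPow, mul_left_comm, factorial_mul_mapDivPow, ← mul_pow, ← map_mul]
      rfl)
    (fun n m x => by
      refine factorial_mul_cancel (n := n) (factorial_mul_cancel (n := m) ?_)
      have h1 := factorial_mul_mapDivPow p π n x
      have h2 := factorial_mul_mapDivPow p π m x
      have h3 := factorial_mul_mapDivPow p π (n + m) x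
      have h4 : ((n + m).choose n : R) * n.factorial * m.factorial = (n + m).factorial := by
        rw [Nat.choose_symm_add]
        exact_mod_cast Nat.add_choose_mul_factorial_mul_factorial n m
      rw [nsmul_eq_mul]
      rw [pow_add, ← h1, ← h2, ← h4] at h3
      linear_combination -h3)
    (fun n x y => by
      refine factorial_mul_cancel (n := n) ?_
      have hxy : π ((x + y : pdIdeal p (RingHom.ker π)) : A) = π x + π y := map_add π (x : A) y
      rw [factorial_mul_mapDivPow, hxy, (Commute.all (π (x : A)) (π (y : A))).add_pow',
        Finset.mul_sum]
      refine Finset.sum_congr rfl fun k hk => ?_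
      rw [Finset.HasAntidiagonal.mem_antidiagonal] at hk
      have h4 : ((k.1 + k.2).choose k.1 : R) * k.1.factorial * k.2.factorial =
          (k.1 + k.2).factorial := by
        rw [Nat.choose_symm_add]
        exact_mod_cast Nat.add_choose_mul_factorial_mul_factorial k.1 k.2
      subst hk
      rw [← factorial_mul_mapDivPow p π k.1 x, ← factorial_mul_mapDivPow p π k.2 y, ← h4,
        nsmul_eq_mul]
      ring)

end Residue

section Windows

variable {S : Type u} [CommRing S]

variable (S) in
/-- The data `(S, Fil S, φ, φ₁, ϖ)` of a frame; the quotient `R` is `S / Fil S`. The definition of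
a window involves only these data, not the axioms of a frame. -/
structure FrameData where
  /-- The ideal `Fil S`. -/
  Fil : Ideal S
  /-- The Frobenius lift. -/
  φ : S →+* S
  /-- The divided Frobenius on `Fil S`. -/
  φ₁ : Fil → S
  /-- The element with `φ = ϖ φ₁` on `Fil S`. -/
  ϖ : S

/-- A window over a frame. -/
structure Window (F : FrameData S) where
  /-- The underlying module. -/
  M : Type w
  [addCommGroup : AddCommGroup M]
  [module : Module S M]
  finite : Module.Finite S M
  projective : Module.Projective S M
  /-- The submodule `Fil M`. -/
  Fil : Submodule S M
  /-- The `φ`-linear map `Φ : M → M`. -/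
  Φ : M →ₛₗ[F.φ] M
  /-- The `φ`-linear map `Φ₁ : Fil M → M`. -/
  Φ₁ : Fil →ₛₗ[F.φ] M
  normal_decomposition : ∃ L N : Submodule S M, IsCompl L N ∧ Fil = L ⊔ F.Fil • N
  Φ₁_smul : ∀ (s : F.Fil) (m : M) (h : (s : S) • m ∈ Fil), Φ₁ ⟨(s : S) • m, h⟩ = F.φ₁ s • Φ m
  Φ_eq : ∀ m : Fil, Φ m = F.ϖ • Φ₁ m
  span_eq_top : Submodule.span S (Set.range Φ₁ ∪ Set.range Φ) = ⊤

attribute [instance] Window.addCommGroup Window.module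

variable {F : FrameData S}

/-- A homomorphism of windows: an `S`-linear map that preserves the filtration and commutes with
`Φ` and `Φ₁`. -/
@[ext]
structure WindowHom (M N : Window.{u, w} F) where
  /-- The underlying linear map. -/
  toLin : M.M →ₗ[S] N.M
  map_fil : ∀ x ∈ M.Fil, toLin x ∈ N.Fil
  map_Φ : ∀ x, toLin (M.Φ x) = N.Φ (toLin x)
  map_Φ₁ : ∀ x : M.Fil, toLin (M.Φ₁ x) = N.Φ₁ ⟨toLin x, map_fil x x.2⟩

/-- The category of windows. -/
instance : Category (Window.{u, w} F) where
  Hom := WindowHom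
  id M := ⟨LinearMap.id, fun _ h => h, fun _ => rfl, fun _ => rfl⟩
  comp f g := ⟨g.toLin ∘ₗ f.toLin, fun x h => g.map_fil _ (f.map_fil x h),
    fun x => by simp [f.map_Φ, g.map_Φ], fun x => by simp [f.map_Φ₁, g.map_Φ₁]⟩

variable {Ω : Type v} [AddCommGroup Ω] [Module S Ω]

/-- `∇ : M → M ⊗ Ω` is a connection over the derivation `dS : S → Ω`. -/
def IsConnection (dS : S →+ Ω) (M : Window.{u, w} F) (nabla : M.M →+ M.M ⊗[S] Ω) : Prop :=
  ∀ (s : S) (m : M.M), nabla (s • m) = s • nabla m + m ⊗ₜ[S] dS s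

/-- `Φ` is horizontal: `∇ ∘ Φ = (Φ ⊗ τ) ∘ ∇`, where `τ : Ω → Ω` is the given `φ`-linear map. -/
def IsHorizontal (τ : Ω →ₛₗ[F.φ] Ω) (M : Window.{u, w} F) (nabla : M.M →+ M.M ⊗[S] Ω) : Prop :=
  ∀ m : M.M, nabla (M.Φ m) = TensorProduct.map M.Φ τ (nabla m)

/-- A window with a connection over `dS` for which `Φ` is horizontal. -/
structure WindowConn (dS : S →+ Ω) (τ : Ω →ₛₗ[F.φ] Ω) where
  /-- The underlying window. -/
  toWindow : Window.{u, w} F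
  /-- The connection. -/
  nabla : toWindow.M →+ toWindow.M ⊗[S] Ω
  isConnection : IsConnection dS toWindow nabla
  isHorizontal : IsHorizontal τ toWindow nabla

variable {dS : S →+ Ω} {τ : Ω →ₛₗ[F.φ] Ω}

/-- A homomorphism of windows that is compatible with the connections. -/
@[ext]
structure WindowConnHom (M N : WindowConn.{u, v, w} dS τ) where
  /-- The underlying homomorphism of windows. -/
  toHom : M.toWindow ⟶ N.toWindow
  map_nabla : ∀ x, N.nabla (toHom.toLin x) = toHom.toLin.rTensor Ω (M.nabla x)

/-- The category of windows with a connection for which `Φ` is horizontal. -/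
instance : Category (WindowConn.{u, v, w} dS τ) where
  Hom := WindowConnHom
  id M := ⟨𝟙 M.toWindow, fun x => (LinearMap.rTensor_id_apply Ω _ (M.nabla x)).symm⟩
  comp {M _ _} f g := ⟨f.toHom ≫ g.toHom, fun x =>
    (g.map_nabla _).trans ((congrArg _ (f.map_nabla x)).trans
      (LinearMap.rTensor_comp_apply Ω g.toHom.toLin f.toHom.toLin (M.nabla x)).symm)⟩
  id_comp f := WindowConnHom.ext (Category.id_comp f.toHom)
  comp_id f := WindowConnHom.ext (Category.comp_id f.toHom)
  assoc f g h := WindowConnHom.ext (Category.assoc f.toHom g.toHom h.toHom)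

variable (dS τ) in
/-- The functor that forgets the connection. -/
def forgetConn : WindowConn.{u, v, w} dS τ ⥤ Window.{u, w} F where
  obj M := M.toWindow
  map f := f.toHom
  map_id _ := rfl
  map_comp _ _ := rfl

end Windows

section Frame

variable {p : ℕ} [Fact p.Prime] {R : Type u} [CommRing R] [IsDomain R] [CharZero R] [IsLocalRing R]
  [CharP (ResidueField R) p] {d : ℕ}

/-- The natural map `S → R`, with values in the `p`-adic completion of `R` (which is `R` itself
when `R` is `p`-adically complete). -/
def toR (π : PS p (ResidueField R) d →+* R) : BS (RingHom.ker π) →+* PCompl p R :=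
  complRingHom p (pdToR p π)

open scoped Classical in
/-- The frame `(S, Fil S, φ, φ₁ = p⁻¹ φ, p)` where `S` is the `p`-adic completion of the divided
power envelope of `ker π` in `𝔖`, and `Fil S` is the kernel of `S → R`. The value of `φ₁` at
`s ∈ Fil S` is the element `t` of the `p`-torsion free ring `S` with `p t = φ(s)`. -/
def frame (π : PS p (ResidueField R) d →+* R)
    (φ : PS p (ResidueField R) d →+* PS p (ResidueField R) d) (hφ : IsFrobeniusLift φ) :
    FrameData (BS (RingHom.ker π)) where
  Fil := RingHom.ker (toR π)
  φ := phiS (RingHom.ker π) φ hφ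
  φ₁ s := if h : ∃ t, (p : BS (RingHom.ker π)) * t = phiS (RingHom.ker π) φ hφ s
    then h.choose else 0
  ϖ := p

/-- The map `φ ⊗ dφ` on `S ⊗_𝔖 Ω̂_𝔖`, as a map that is linear over the Frobenius of the frame. -/
def frameDPhi (π : PS p (ResidueField R) d →+* R)
    (φ : PS p (ResidueField R) d →+* PS p (ResidueField R) d) (hφ : IsFrobeniusLift φ) :
    OmegaS (RingHom.ker π) →ₛₗ[(frame π φ hφ).φ] OmegaS (RingHom.ker π) :=
  dPhiS (RingHom.ker π) φ hφ

end Frame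

end BreuilWindow

end

noncomputable section

namespace BreuilWindow

/-! ### Contracting semilinear operators -/

section Semilinear

variable {S : Type u} [CommRing S] {φ : S →+* S}

/-! Write Ω for `S ⊗ Ω̂_𝔖`, τ for φ ⊗ dφ and τ₁ for φ ⊗ (dφ)₁, so that τ = p τ₁. A normal
decomposition M = L ⊕ N yields the φ-linear map Ψ = Φ₁ ⊕ Φ, whose image spans M, and the linear map
g = 1 ⊕ p, with Φ ∘ g = p Ψ. Since S has no p-torsion, horizontality of Φ can be divided by p: it is
equivalent to ∇ ∘ Ψ = U ∘ ∇ ∘ g with U = Φ ⊗ τ₁.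

The ring S is local, so M is free; if (bᵢ) is a basis, then so is (Ψ bᵢ). Connections form a torsor
under Hom(M, M ⊗ Ω), and for ∇ = ∇₀ + A the condition becomes (1 - T) A = C, where C depends only on
∇₀ and T is the φ-linear operator with T(A)(Ψ bᵢ) = U(A(g bᵢ)). Unique existence of ∇ is therefore
bijectivity of 1 - T (`bijective_sub_semilinear`). The same operator on Hom(M, N ⊗ Ω) shows that the
defect of compatibility of a window homomorphism with two horizontal connections vanishes, so the
forgetful functor is full. It is visibly faithful, and existence of ∇ makes it essentially
surjective.

Bijectivity of 1 - T rests on the map q : S → R/p. It satisfies q(φ(s)) = q(s)^p and φ(ker q) ⊆ pS.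
Nilpotency of (dφ)₁ modulo the maximal ideal makes T topologically nilpotent modulo ker q, and R/p
is complete for its maximal ideal, so a Neumann series solves the equation modulo ker q. As T sends
vectors with entries in ker q to multiples of p, one correction gives a solution modulo p, and
p-adic completeness of S finishes.

What remains concerns S itself. The envelope is p-torsion free because ker π is generated by one
element E = p - e with e in (u₁, …, u_d), and the divided powers of E satisfy only the relations
visible in the fraction field (`BS_torsionFree`). The map φ lifts Frobenius on S and makes positive
divided powers divisible by p (`p_dvd_phiS_sub_pow`, `exists_phiS_eq_p_mul`). Finally d ∘ φ = dφ ∘ d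
on 𝔖 by Nakayama's lemma (`univD_map`), and this extends to S (`nablaS_phiS`). -/

theorem iterate_map_smul {V : Type w} [AddCommGroup V] [Module S V] (T : V →ₛₗ[φ] V) (n : ℕ)
    (s : S) (v : V) : T^[n] (s • v) = φ^[n] s • T^[n] v := by
  induction n generalizing s v with
  | zero => rfl
  | succ n ih => rw [Function.iterate_succ_apply, Function.iterate_succ_apply,
      Function.iterate_succ_apply, T.map_smulₛₗ, ih]

theorem iterate_map_sum {V : Type w} [AddCommGroup V] [Module S V] (T : V →ₛₗ[φ] V) (n : ℕ)
    {ι : Type*} (s : Finset ι) (v : ι → V) : T^[n] (∑ i ∈ s, v i) = ∑ i ∈ s, T^[n] (v i) := by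
  induction n generalizing v with
  | zero => rfl
  | succ n ih => simp only [Function.iterate_succ_apply, map_sum, ih]

/-- If `φ` induces a power map on a quotient `R'` of `S`, then a `φ`-linear endomorphism of `S^ι`
whose image has coordinates in `𝔞` maps vectors with coordinates in `𝔟` to vectors with
coordinates in `𝔟𝔞`, modulo the kernel of `S → R'`. -/
theorem iterate_mem_mul {R' : Type v} [CommRing R'] (q : S →+* R') {e : ℕ} (he : e ≠ 0)
    (hqφ : ∀ s, q (φ s) = q s ^ e) {ι : Type*} [Fintype ι] (T : (ι → S) →ₛₗ[φ] (ι → S))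
    (n : ℕ) (𝔞 𝔟 : Ideal R') (hT : ∀ v i, q (T^[n] v i) ∈ 𝔞) (v : ι → S) (hv : ∀ i, q (v i) ∈ 𝔟)
    (i : ι) : q (T^[n] v i) ∈ 𝔟 * 𝔞 := by
  classical
  have hφ : ∀ (m : ℕ) (s : S), q s ∈ 𝔟 → q (φ^[m] s) ∈ 𝔟 := by
    intro m
    induction m with
    | zero => exact fun s hs => hs
    | succ m ih =>
      intro s hs
      rw [Function.iterate_succ_apply]
      refine ih _ ?_
      rw [hqφ]
      exact Ideal.pow_mem_of_mem _ hs e (Nat.pos_of_ne_zero he)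
  rw [pi_eq_sum_univ v, iterate_map_sum, Finset.sum_apply, map_sum]
  refine Ideal.sum_mem _ fun j _ => ?_
  rw [iterate_map_smul, Pi.smul_apply, smul_eq_mul, map_mul]
  exact Ideal.mul_mem_mul (hφ n _ (hv j)) (hT _ _)

variable {R' : Type v} [CommRing R']

/-- Topologically nilpotent semilinear maps: `1 - T` is bijective on `S^ι`. -/
theorem bijective_sub_semilinear_pi (p : ℕ) [IsAdicComplete (Ideal.span {(p : S)}) S]
    (hp : ∀ s : S, (p : S) * s = 0 → s = 0) (q : S →+* R') (hq : Function.Surjective q)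
    (𝔫 : Ideal R') [IsAdicComplete 𝔫 R'] (hker : ∀ s, q s = 0 → ∃ t, φ s = p * t)
    {e : ℕ} (he : e ≠ 0) (hqφ : ∀ s, q (φ s) = q s ^ e)
    {ι : Type*} [Finite ι] (T : (ι → S) →ₛₗ[φ] (ι → S))
    (n : ℕ) (hT : ∀ v i, q (T^[n] v i) ∈ 𝔫) :
    Function.Bijective fun v => v - T v := by
  classical
  have := Fintype.ofFinite ι
  -- Each block of `n` applications of `T` gains one more factor `𝔫`.
  have hpow : ∀ k v i, q (T^[n * k] v i) ∈ 𝔫 ^ k := by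
    intro k
    induction k with
    | zero => simp
    | succ k ih =>
      intro v i
      rw [Nat.mul_succ, add_comm (n * k), Function.iterate_add_apply, pow_succ]
      exact iterate_mem_mul q he hqφ T n 𝔫 (𝔫 ^ k) hT _ (ih v) i
  have hTk : ∀ k (v : ι → S), (∀ i, q (v i) ∈ 𝔫 ^ k) → ∀ i, q (T v i) ∈ 𝔫 ^ k := by
    intro k v hv i
    simpa using iterate_mem_mul q he hqφ T 1 ⊤ (𝔫 ^ k) (by simp) v hv i
  -- In the standard basis `T v = ∑ φ(vᵢ) T(eᵢ)`, and `φ` maps the kernel of `q` into `pS`.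
  have hdiv : ∀ v : ι → S, (∀ i, q (v i) = 0) → ∃ w, T v = (p : S) • w := by
    intro v hv
    choose t ht using fun i => hker (v i) (hv i)
    refine ⟨∑ i, t i • T fun j => if i = j then 1 else 0, ?_⟩
    conv_lhs => rw [pi_eq_sum_univ v]
    simp only [map_sum, Finset.smul_sum, LinearMap.map_smulₛₗ, ht, mul_smul]
  have hsep : ∀ v : ι → S, (∀ k, ∃ w, v = (p : S) ^ k • w) → v = 0 := by
    intro v hv
    funext i
    refine IsHausdorff.haus (I := Ideal.span {(p : S)}) inferInstance (v i) fun k => ?_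
    obtain ⟨w, rfl⟩ := hv k
    rw [SModEq.zero, Ideal.span_singleton_pow, smul_eq_mul, Ideal.mul_top]
    exact Ideal.mem_span_singleton.2 ⟨w i, rfl⟩
  have hsepq : ∀ r : R', (∀ k, r ∈ 𝔫 ^ k) → r = 0 := fun r hr =>
    IsHausdorff.haus (I := 𝔫) inferInstance r fun k => by simpa [SModEq.zero] using hr k
  constructor
  · -- a fixed vector is infinitely divisible by `p`
    have key : ∀ v : ι → S, T v = v → ∃ w, T w = w ∧ v = (p : S) • w := by
      intro v hv
      have h0 : ∀ i, q (v i) = 0 := fun i => hsepq _ fun k => by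
        have := hpow k v i
        rwa [Function.iterate_fixed hv] at this
      obtain ⟨w, hw⟩ := hdiv v h0
      refine ⟨w, ?_, hv ▸ hw⟩
      -- `T` commutes with multiplication by `p`, so torsion-freeness passes the fixed-point
      -- property from `v = p w` to `w`.
      have : (p : S) • (T w - w) = 0 := by
        rw [smul_sub, ← map_natCast φ p, ← T.map_smulₛₗ, map_natCast, ← hw, hv, hv, sub_self]
      rw [← sub_eq_zero]
      funext i
      exact hp _ (congrFun this i)
    have key' : ∀ k (v : ι → S), T v = v → ∃ w, T w = w ∧ v = (p : S) ^ k • w := by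
      intro k
      induction k with
      | zero => exact fun v hv => ⟨v, hv, by simp⟩
      | succ k ih =>
        intro v hv
        obtain ⟨w, hw, rfl⟩ := ih v hv
        obtain ⟨w', hw', rfl⟩ := key w hw
        exact ⟨w', hw', by rw [pow_succ, mul_smul]⟩
    intro v w hvw
    rw [← sub_eq_zero]
    refine hsep _ fun k => ?_
    have hfix : T (v - w) = v - w := by
      rw [map_sub]
      have h : v - T v = w - T w := hvw
      rw [sub_eq_sub_iff_add_eq_add] at h ⊢
      rw [add_comm, ← h, add_comm]
    obtain ⟨w', -, h⟩ := key' k _ hfix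
    exact ⟨w', h⟩
  · -- solve modulo `p` first
    have key : ∀ v : ι → S, ∃ w x, w - T w = v + (p : S) • x := by
      intro v
      let s : ℕ → ι → S := fun k => ∑ j ∈ Finset.range (n * k), T^[j] v
      have hs : ∀ k, s k - T (s k) = v - T^[n * k] v := by
        intro k
        simp only [s, map_sum, ← Function.iterate_succ_apply' T]
        rw [← Finset.sum_sub_distrib, Finset.sum_range_sub' (fun j => T^[j] v)]
        rfl
      have hcau : ∀ {k l : ℕ}, k ≤ l → ∀ i, q (s l i) - q (s k i) ∈ 𝔫 ^ k := by
        intro k l hkl i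
        -- The tail of the Neumann series is `T^[n * k]` of a partial sum, so the partial sums are
        -- Cauchy after applying `q`.
        have h1 : s l = s k + T^[n * k] (∑ j ∈ Finset.range (n * l - n * k), T^[j] v) := by
          simp only [s]
          rw [iterate_map_sum]
          have := Finset.sum_range_add (fun j => T^[j] v) (n * k) (n * l - n * k)
          rw [Nat.add_sub_cancel' (Nat.mul_le_mul_left n hkl)] at this
          rw [this]
          simp only [Function.iterate_add_apply]
        rw [← map_sub, h1, Pi.add_apply, add_sub_cancel_left]
        exact hpow k _ i
      have hlim : ∀ i, ∃ L : R', ∀ k, q (s k i) - L ∈ 𝔫 ^ k := by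
        intro i
        obtain ⟨L, hL⟩ := IsPrecomplete.prec (I := 𝔫) inferInstance (f := fun k => q (s k i))
          (fun {k l} hkl => by
            rw [SModEq.comm, SModEq.sub_mem, smul_eq_mul, Ideal.mul_top]
            exact hcau hkl i)
        exact ⟨L, fun k => by simpa [SModEq.sub_mem] using hL k⟩
      choose L hL using hlim
      choose w hw using fun i => hq (L i)
      have hz : ∀ i, q ((w - T w - v) i) = 0 := by
        intro i
        refine hsepq _ fun k => ?_
        have h1 : ∀ i, q ((w - s k) i) ∈ 𝔫 ^ k := fun i => by
          rw [Pi.sub_apply, map_sub, hw, ← neg_sub]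
          exact neg_mem (hL i k)
        have h2 := hTk k _ h1 i
        have h3 : w - T w - v = (w - s k) - T (w - s k) - T^[n * k] v := by
          rw [map_sub]
          have := hs k
          linear_combination this
        rw [h3, Pi.sub_apply, Pi.sub_apply, map_sub, map_sub]
        exact sub_mem (sub_mem (h1 i) h2) (hpow k v i)
      obtain ⟨x, hx⟩ := hdiv _ hz
      -- The lift `w` has error `z = w - T w - v`, which is only known to lie in the kernel of `q`.
      -- Replacing `w` by `w - z` changes the error from `z` to `T z`, which is divisible by `p`.
      refine ⟨w - (w - T w - v), x, ?_⟩
      rw [map_sub, hx]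
      abel
    intro v
    choose W Xx hWX using key
    -- the successive remainders
    let r : ℕ → ι → S := fun k => Nat.rec v (fun _ r => -Xx r) k
    let t : ℕ → ι → S := fun k => ∑ j ∈ Finset.range k, (p : S) ^ j • W (r j)
    have hTp : ∀ k w, T ((p : S) ^ k • w) = (p : S) ^ k • T w := fun k w => by
      rw [T.map_smulₛₗ, map_pow, map_natCast]
    have ht : ∀ k, t k - T (t k) = v - (p : S) ^ k • r k := by
      intro k
      induction k with
      | zero => simp [t, r]
      | succ k ih =>
        have h1 : t (k + 1) = t k + (p : S) ^ k • W (r k) := Finset.sum_range_succ _ _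
        have h2 : r (k + 1) = -Xx (r k) := rfl
        rw [h1, map_add, hTp, add_sub_add_comm, ih, ← smul_sub, hWX, h2, pow_succ, mul_smul,
          smul_neg, smul_neg, smul_add]
        abel
    have hcau : ∀ {k l : ℕ}, k ≤ l → ∀ i, (p : S) ^ k ∣ t l i - t k i := by
      intro k l hkl i
      have h1 := Finset.sum_range_add (fun j => (p : S) ^ j • W (r j)) k (l - k)
      rw [Nat.add_sub_cancel' hkl] at h1
      have h2 : t l - t k = ∑ j ∈ Finset.range (l - k), (p : S) ^ (k + j) • W (r (k + j)) := by
        rw [sub_eq_iff_eq_add', ← h1]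
      rw [← Pi.sub_apply, h2, Finset.sum_apply]
      refine Finset.dvd_sum fun j _ => ?_
      rw [pow_add, mul_smul]
      exact Dvd.intro _ rfl
    have hlim : ∀ i, ∃ L : S, ∀ k, (p : S) ^ k ∣ t k i - L := by
      intro i
      obtain ⟨L, hL⟩ := IsPrecomplete.prec (I := Ideal.span {(p : S)}) inferInstance
        (f := fun k => t k i) (fun {k l} hkl => by
          rw [SModEq.comm, SModEq.sub_mem, smul_eq_mul, Ideal.mul_top, Ideal.span_singleton_pow,
            Ideal.mem_span_singleton]
          exact hcau hkl i)
      refine ⟨L, fun k => ?_⟩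
      have := hL k
      rwa [SModEq.sub_mem, smul_eq_mul, Ideal.mul_top, Ideal.span_singleton_pow,
        Ideal.mem_span_singleton] at this
    choose L hL using hlim
    refine ⟨L, ?_⟩
    change L - T L = v
    rw [← sub_eq_zero]
    refine hsep _ fun k => ?_
    choose c hc using fun i => hL i k
    have h1 : L = t k - (p : S) ^ k • c := by
      funext i
      have := hc i
      simp only [Pi.sub_apply, Pi.smul_apply, smul_eq_mul]
      linear_combination -this
    refine ⟨-c + T c - r k, ?_⟩
    have h2 := ht k
    rw [h1, map_sub, hTp, smul_sub, smul_add, smul_neg]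
    linear_combination h2

/-- Topologically nilpotent semilinear maps: `1 - T` is bijective on a finite free module. -/
theorem bijective_sub_semilinear (p : ℕ) [IsAdicComplete (Ideal.span {(p : S)}) S]
    (hp : ∀ s : S, (p : S) * s = 0 → s = 0) (q : S →+* R') (hq : Function.Surjective q)
    (𝔫 : Ideal R') [IsAdicComplete 𝔫 R'] (hker : ∀ s, q s = 0 → ∃ t, φ s = p * t)
    {e : ℕ} (he : e ≠ 0) (hqφ : ∀ s, q (φ s) = q s ^ e)
    {V : Type w} [AddCommGroup V] [Module S V] [Module.Finite S V] [Module.Free S V]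
    (T : V →ₛₗ[φ] V) (n : ℕ) (hT : ∀ v, T^[n] v ∈ 𝔫.comap q • (⊤ : Submodule S V)) :
    Function.Bijective fun v => v - T v := by
  let E := (Module.Free.chooseBasis S V).equivFun
  let T' : (Module.Free.ChooseBasisIndex S V → S) →ₛₗ[φ] (Module.Free.ChooseBasisIndex S V → S) :=
    { toFun := fun x => E (T (E.symm x))
      map_add' := fun x y => by simp only [map_add]
      map_smul' := fun s x => by simp only [map_smul, LinearMap.map_smulₛₗ] }
  have hsemi : Function.Semiconj E T T' := fun v => by
    change E (T v) = E (T (E.symm (E v)))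
    rw [E.symm_apply_apply]
  have h := bijective_sub_semilinear_pi p hp q hq 𝔫 hker he hqφ T' n (fun x i => by
    obtain ⟨v, rfl⟩ := E.surjective x
    rw [← (hsemi.iterate_right n) v]
    have h1 := Submodule.smul_top_le_comap_smul_top (𝔫.comap q)
      ((LinearMap.proj i).comp E.toLinearMap) (hT v)
    rw [Submodule.mem_comap, smul_eq_mul, Ideal.mul_top] at h1
    exact h1)
  have h2 : (fun v => v - T v) = E.symm ∘ (fun x => x - T' x) ∘ E := by
    funext v
    simp only [Function.comp_apply, ← hsemi v, ← map_sub, E.symm_apply_apply]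
  rw [h2]
  exact E.symm.bijective.comp (h.comp E.bijective)

end Semilinear

/-! ### Twisted operators on spaces of linear maps -/

section SpanBasis

variable {S : Type u} [CommRing S]

/-- The images of a basis under a semilinear map whose image spans form a basis. -/
theorem exists_basis_of_span_range_eq_top {φ : S →+* S} {M : Type w} [AddCommGroup M] [Module S M]
    {ι : Type*} [Finite ι] (b : Module.Basis ι S M) (Ψ : M →ₛₗ[φ] M)
    (hΨ : Submodule.span S (Set.range Ψ) = ⊤) :
    ∃ b' : Module.Basis ι S M, ∀ i, b' i = Ψ (b i) := by
  have := Fintype.ofFinite ι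
  have : Module.Finite S M := Module.Finite.of_basis b
  have hspan : Submodule.span S (Set.range fun i => Ψ (b i)) = ⊤ := by
    rw [eq_top_iff, ← hΨ, Submodule.span_le]
    rintro _ ⟨x, rfl⟩
    rw [← b.sum_repr x, map_sum]
    refine Submodule.sum_mem _ fun i _ => ?_
    rw [Ψ.map_smulₛₗ]
    exact Submodule.smul_mem _ _ (Submodule.subset_span ⟨i, rfl⟩)
  let f : M →ₗ[S] M := b.constr S fun i => Ψ (b i)
  have hf : Function.Surjective f := by
    rw [← LinearMap.range_eq_top, eq_top_iff, ← hspan, Submodule.span_le]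
    rintro _ ⟨i, rfl⟩
    exact ⟨b i, b.constr_basis S _ i⟩
  have hbij : Function.Bijective f :=
    ⟨OrzechProperty.injective_of_surjective_endomorphism f hf, hf⟩
  refine ⟨b.map (LinearEquiv.ofBijective f hbij), fun i => ?_⟩
  rw [Module.Basis.map_apply, LinearEquiv.ofBijective_apply]
  exact b.constr_basis S _ i

/-- The semilinear operator on `X^ι ≅ Hom(M, X)` that sends `A` to the map `T(A)` determined by
`T(A)(b' i) = U(A(g(b i)))`. -/
def twistOperator {φ : S →+* S} {M : Type w} [AddCommGroup M] [Module S M] {X : Type v}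
    [AddCommGroup X] [Module S X] {ι : Type*} (b b' : Module.Basis ι S M) (g : M →ₗ[S] M)
    (U : X →ₛₗ[φ] X) : (ι → X) →ₛₗ[φ] (ι → X) where
  toFun v := fun i => U (b'.constr S v (g (b i)))
  map_add' v w := by
    funext i
    simp only [map_add, LinearMap.add_apply, Pi.add_apply]
  map_smul' s v := by
    funext i
    simp only [map_smul, LinearMap.smul_apply, LinearMap.map_smulₛₗ, Pi.smul_apply]

theorem twistOperator_apply {φ : S →+* S} {M : Type w} [AddCommGroup M] [Module S M] {X : Type v}
    [AddCommGroup X] [Module S X] {ι : Type*} (b b' : Module.Basis ι S M) (g : M →ₗ[S] M)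
    (U : X →ₛₗ[φ] X) (v : ι → X) (i : ι) :
    twistOperator b b' g U v i = U (b'.constr S v (g (b i))) := rfl

/-- Each application of the operator puts one more `U` on the values and otherwise forms linear
combinations, so the values of the `k`-th iterate lie in the span of the image of `U^[k]`.
Contraction of `U` thus passes to the operator, whatever `g` is. -/
theorem iterate_twistOperator_mem {φ : S →+* S} {M : Type w} [AddCommGroup M] [Module S M]
    {X : Type v} [AddCommGroup X] [Module S X] {ι : Type*} [Finite ι]
    (b b' : Module.Basis ι S M) (g : M →ₗ[S] M) (U : X →ₛₗ[φ] X) (𝔞 : Ideal S) (n : ℕ)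
    (hU : ∀ x, U^[n] x ∈ 𝔞 • (⊤ : Submodule S X)) (v : ι → X) :
    (twistOperator b b' g U)^[n] v ∈ 𝔞 • (⊤ : Submodule S (ι → X)) := by
  classical
  have := Fintype.ofFinite ι
  have hstep : ∀ k, ∀ x ∈ Submodule.span S (Set.range U^[k]),
      U x ∈ Submodule.span S (Set.range U^[k + 1]) := by
    intro k x hx
    induction hx using Submodule.span_induction with
    | mem x hx =>
      obtain ⟨y, rfl⟩ := hx
      rw [← Function.iterate_succ_apply' U]
      exact Submodule.subset_span ⟨y, rfl⟩
    | zero => simp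
    | add x y _ _ hx hy => rw [map_add]; exact add_mem hx hy
    | smul s x _ hx => rw [U.map_smulₛₗ]; exact Submodule.smul_mem _ _ hx
  have key : ∀ (k : ℕ) (m : M), b'.constr S ((twistOperator b b' g U)^[k] v) m ∈
      Submodule.span S (Set.range U^[k]) := by
    intro k
    induction k with
    | zero => exact fun m => Submodule.subset_span (Set.mem_range_self (f := U^[0]) _)
    | succ k ih =>
      intro m
      rw [Function.iterate_succ_apply', b'.constr_apply_fintype S]
      refine Submodule.sum_mem _ fun i _ => Submodule.smul_mem _ _ ?_
      exact hstep k _ (ih _)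
  have hle : Submodule.span S (Set.range U^[n]) ≤ 𝔞 • (⊤ : Submodule S X) := by
    rw [Submodule.span_le]
    rintro _ ⟨x, rfl⟩
    exact hU x
  have hv : ∀ i, (twistOperator b b' g U)^[n] v i ∈ 𝔞 • (⊤ : Submodule S X) := by
    intro i
    have := hle (key n (b' i))
    rwa [b'.constr_basis] at this
  rw [← LinearMap.sum_single_apply (fun _ : ι => X) ((twistOperator b b' g U)^[n] v)]
  refine Submodule.sum_mem _ fun i _ => ?_
  exact Submodule.smul_top_le_comap_smul_top 𝔞 (LinearMap.single S (fun _ : ι => X) i) (hv i)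

end SpanBasis

/-! ### Normal decompositions of windows -/

section NormalDecomposition

variable {S : Type u} [CommRing S] {F : FrameData S}

/-- The `φ`-linear map `Ψ = Φ₁ ⊕ Φ` attached to a normal decomposition `M = L ⊕ N`, together with
the maps `1 ⊕ ϖ` and `ϖ ⊕ 1`. -/
theorem Window.exists_normal_operator (M : Window.{u, w} F) (hϖ : F.φ F.ϖ = F.ϖ) :
    ∃ (Ψ : M.M →ₛₗ[F.φ] M.M) (g g' : M.M →ₗ[S] M.M), (∀ x, M.Φ (g x) = F.ϖ • Ψ x) ∧
      (∀ x, Ψ (g' x) = M.Φ x) ∧ (∀ x, g (g' x) = F.ϖ • x) ∧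
      Submodule.span S (Set.range Ψ) = ⊤ := by
  obtain ⟨L, N, hLN, hFil⟩ := M.normal_decomposition
  have hL : L ≤ M.Fil := hFil ▸ le_sup_left
  let pL : M.M →ₗ[S] L := L.projectionOnto N hLN
  let pN : M.M →ₗ[S] N := N.projectionOnto L hLN.symm
  have hsum : ∀ x, (pL x : M.M) + (pN x : M.M) = x :=
    fun x => Submodule.projection_add_projection_eq_self hLN x
  have hpLL : ∀ l : L, pL l = l := fun l => Submodule.projectionOnto_apply_left hLN l
  have hpNN : ∀ n : N, pN n = n := fun n => Submodule.projectionOnto_apply_left hLN.symm n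
  have hpLN : ∀ n : N, pL n = 0 := fun n => Submodule.projectionOnto_apply_right hLN n
  have hpNL : ∀ l : L, pN l = 0 := fun l => Submodule.projectionOnto_apply_right hLN.symm l
  let Ψ : M.M →ₛₗ[F.φ] M.M :=
    M.Φ₁.comp ((Submodule.inclusion hL).comp pL) + M.Φ.comp (N.subtype.comp pN)
  have hΨ : ∀ x, Ψ x = M.Φ₁ (Submodule.inclusion hL (pL x)) + M.Φ (pN x) := fun _ => rfl
  have hΦ₁ : ∀ l : L, M.Φ l = F.ϖ • M.Φ₁ (Submodule.inclusion hL l) :=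
    fun l => M.Φ_eq (Submodule.inclusion hL l)
  have h2 : ∀ x, Ψ (F.ϖ • (pL x : M.M) + (pN x : M.M)) = M.Φ x := by
    intro x
    rw [hΨ]
    simp only [map_add, map_smul, hpLL, hpNN, hpLN, hpNL, add_zero, smul_zero, zero_add,
      LinearMap.map_smulₛₗ, hϖ]
    rw [← hΦ₁, ← map_add, hsum]
  refine ⟨Ψ, L.subtype.comp pL + F.ϖ • N.subtype.comp pN,
    F.ϖ • L.subtype.comp pL + N.subtype.comp pN, fun x => ?_, fun x => h2 x, fun x => ?_, ?_⟩
  · simp only [LinearMap.add_apply, LinearMap.smul_apply, LinearMap.comp_apply,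
      Submodule.subtype_apply, map_add, LinearMap.map_smulₛₗ, hϖ, hΨ, smul_add, hΦ₁]
  · simp only [LinearMap.add_apply, LinearMap.smul_apply, LinearMap.comp_apply,
      Submodule.subtype_apply, map_add, map_smul, hpLL, hpNN, hpLN, hpNL, add_zero, smul_zero,
      zero_add, Submodule.coe_zero]
    rw [← smul_add, hsum]
  · rw [eq_top_iff, ← M.span_eq_top, Submodule.span_le]
    have hrange : ∀ x, Ψ x ∈ Submodule.span S (Set.range Ψ) :=
      fun x => Submodule.subset_span ⟨x, rfl⟩
    have hΦ : ∀ x, M.Φ x ∈ Submodule.span S (Set.range Ψ) := fun x => h2 x ▸ hrange _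
    rintro _ (⟨x, rfl⟩ | ⟨x, rfl⟩)
    · obtain ⟨x, hx⟩ := x
      -- On `Fil S · N` the values of `Φ₁` are combinations of values of `Φ`, and `Φ` factors
      -- through `Ψ`; on `L` the map `Φ₁` is `Ψ` itself.
      have hN : ∀ y ∈ F.Fil • N, ∀ h : y ∈ M.Fil,
          M.Φ₁ ⟨y, h⟩ ∈ Submodule.span S (Set.range Ψ) := by
        intro y hy
        have hle : F.Fil • N ≤ M.Fil := hFil ▸ le_sup_right
        induction hy using Submodule.smul_induction_on' with
        | smul s hs n hn =>
          intro h
          rw [M.Φ₁_smul ⟨s, hs⟩ n h]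
          exact Submodule.smul_mem _ _ (hΦ n)
        | add y hy z hz ihy ihz =>
          intro h
          have : (⟨y + z, h⟩ : M.Fil) = ⟨y, hle hy⟩ + ⟨z, hle hz⟩ := rfl
          rw [this, map_add]
          exact add_mem (ihy _) (ihz _)
      have hx' := hx
      rw [hFil] at hx'
      obtain ⟨l, hl, y, hy, rfl⟩ := Submodule.mem_sup.1 hx'
      have hle : F.Fil • N ≤ M.Fil := hFil ▸ le_sup_right
      have : (⟨l + y, hx⟩ : M.Fil) = ⟨l, hL hl⟩ + ⟨y, hle hy⟩ := rfl
      rw [this, map_add]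
      refine add_mem ?_ (hN y hy _)
      have h3 := hΨ l
      rw [hpLL ⟨l, hl⟩, hpNL ⟨l, hl⟩] at h3
      rw [show M.Φ₁ ⟨l, hL hl⟩ = Ψ l by
        rw [h3, Submodule.coe_zero, map_zero, add_zero]
        rfl]
      exact hrange l
    · exact hΦ x

end NormalDecomposition

/-! ### Horizontal connections over a contracting frame -/

section Contracting

variable {S : Type u} [CommRing S] {R' : Type v} [CommRing R']

/-- The properties of the Frobenius of a `p`-torsion free frame that enter into the construction of
connections: modulo `p`, it factors over a quotient `R'` of `S`, on which it induces the
`p`-power map. -/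
structure IsContracting (p : ℕ) (F : FrameData S) (q : S →+* R') : Prop where
  ne_zero : p ≠ 0
  ϖ_eq : F.ϖ = p
  torsionFree : ∀ s : S, (p : S) * s = 0 → s = 0
  surjective : Function.Surjective q
  φ_ker : ∀ s, q s = 0 → ∃ t, F.φ s = p * t
  map_φ : ∀ s, q (F.φ s) = q s ^ p

theorem eq_of_natCast_smul_eq {p : ℕ} (hp : ∀ s : S, (p : S) * s = 0 → s = 0) {X : Type w}
    [AddCommGroup X] [Module S X] [Module.Free S X] {x y : X}
    (h : (p : S) • x = (p : S) • y) : x = y := by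
  rw [← sub_eq_zero, ← smul_sub] at h
  rw [← sub_eq_zero]
  refine (Module.Free.chooseBasis S X).ext_elem fun i => ?_
  have h1 := congrArg (fun z => (Module.Free.chooseBasis S X).repr z i) h
  simp only [map_smul, map_zero, Finsupp.smul_apply, smul_eq_mul, Finsupp.zero_apply] at h1
  rw [hp _ h1, map_zero, Finsupp.zero_apply]

variable {p : ℕ} {F : FrameData S} {q : S →+* R'} (hF : IsContracting p F q)
  {Ω : Type v} [AddCommGroup Ω] [Module S Ω]
include hF

theorem IsContracting.φ_ϖ : F.φ F.ϖ = F.ϖ := by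
  rw [hF.ϖ_eq, map_natCast]

-- The iterates act factorwise on pure tensors, so contraction of `τ₁` alone suffices and `Φ` may be
-- arbitrary.
omit hF in
theorem iterate_map_tmul_mem {𝔞 : Ideal S} {τ₁ : Ω →ₛₗ[F.φ] Ω} {n : ℕ}
    (hτ₁ : ∀ ω, τ₁^[n] ω ∈ 𝔞 • (⊤ : Submodule S Ω)) {M : Type w} [AddCommGroup M] [Module S M]
    (Φ : M →ₛₗ[F.φ] M) (x : M ⊗[S] Ω) :
    (TensorProduct.map Φ τ₁)^[n] x ∈ 𝔞 • (⊤ : Submodule S (M ⊗[S] Ω)) := by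
  induction x using TensorProduct.induction_on with
  | zero => rw [iterate_map_zero]; exact zero_mem _
  | add x y hx hy => rw [iterate_map_add]; exact add_mem hx hy
  | tmul m ω =>
    have h : ∀ k, (TensorProduct.map Φ τ₁)^[k] (m ⊗ₜ[S] ω) = Φ^[k] m ⊗ₜ[S] τ₁^[k] ω := by
      intro k
      induction k with
      | zero => rfl
      | succ k ih => rw [Function.iterate_succ_apply', ih, TensorProduct.map_tmul,
          ← Function.iterate_succ_apply' Φ, ← Function.iterate_succ_apply' τ₁]
    rw [h n]
    exact Submodule.smul_top_le_comap_smul_top 𝔞 (TensorProduct.mk S M Ω (Φ^[n] m)) (hτ₁ ω)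

variable [IsLocalRing S] [IsAdicComplete (Ideal.span {(p : S)}) S] (𝔫 : Ideal R')
  [IsAdicComplete 𝔫 R'] [Module.Free S Ω] [Module.Finite S Ω]
  {τ τ₁ : Ω →ₛₗ[F.φ] Ω} (hτ : ∀ ω, τ ω = (p : S) • τ₁ ω) {n : ℕ}
  (hτ₁ : ∀ ω, τ₁^[n] ω ∈ 𝔫.comap q • (⊤ : Submodule S Ω))
include 𝔫 hτ hτ₁

omit [IsLocalRing S] [IsAdicComplete (Ideal.span {(p : S)}) S] [IsAdicComplete 𝔫 R']
  [Module.Free S Ω] [Module.Finite S Ω] hF hτ₁ 𝔫 in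
theorem map_eq_natCast_smul_map {M : Type w} [AddCommGroup M] [Module S M] (Φ : M →ₛₗ[F.φ] M)
    (x : M ⊗[S] Ω) : TensorProduct.map Φ τ x = (p : S) • TensorProduct.map Φ τ₁ x := by
  induction x using TensorProduct.induction_on with
  | zero => simp
  | add x y hx hy => simp only [map_add, smul_add, hx, hy]
  | tmul m ω => rw [TensorProduct.map_tmul, TensorProduct.map_tmul, hτ, TensorProduct.tmul_smul]

/-- A linear map `M → N ⊗ Ω` that commutes with the Frobenius is zero. -/
theorem IsContracting.eq_zero_of_horizontal (M N : Window.{u, w} F) (B : M.M →ₗ[S] N.M ⊗[S] Ω)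
    (hB : ∀ m, B (M.Φ m) = TensorProduct.map N.Φ τ (B m)) : B = 0 := by
  have := M.finite
  have := M.projective
  have := N.finite
  have := N.projective
  have : Module.Free S M.M := Module.free_of_flat_of_isLocalRing
  have : Module.Free S N.M := Module.free_of_flat_of_isLocalRing
  obtain ⟨Ψ, g, g', hg, -, -, hspan⟩ := M.exists_normal_operator hF.φ_ϖ
  let b := Module.Free.chooseBasis S M.M
  obtain ⟨b', hb'⟩ := exists_basis_of_span_range_eq_top b Ψ hspan
  let U := TensorProduct.map N.Φ τ₁
  have hbij := bijective_sub_semilinear p hF.torsionFree q hF.surjective 𝔫 hF.φ_ker hF.ne_zero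
    hF.map_φ (twistOperator b b' g U) n
    (iterate_twistOperator_mem b b' g U _ n (iterate_map_tmul_mem hτ₁ N.Φ))
  let v := fun i => B (b' i)
  have hv : b'.constr S v = B := b'.ext fun i => b'.constr_basis S v i
  -- Cancelling `p` in `p B(Ψ x) = B(Φ(g x)) = p U(B(g x))` shows that `B` is a fixed point of the
  -- twisted operator, hence zero by injectivity of `1 - T`.
  have h0 : v = 0 := by
    refine hbij.1 ?_
    change v - _ = 0 - _
    rw [map_zero, sub_zero, sub_eq_zero]
    funext i
    rw [twistOperator_apply, hv]
    refine eq_of_natCast_smul_eq hF.torsionFree ?_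
    rw [← map_eq_natCast_smul_map hτ, ← hB, hg, hF.ϖ_eq, map_smul, ← hb']
  rw [← hv, h0, map_zero]

/-- Two connections on the target and the source for which the Frobenius is horizontal are
compatible with all homomorphisms of windows. -/
theorem IsContracting.map_nabla {dS : S →+ Ω} {M N : Window.{u, w} F} (f : WindowHom M N)
    {nablaM : M.M →+ M.M ⊗[S] Ω} {nablaN : N.M →+ N.M ⊗[S] Ω}
    (hM : IsConnection dS M nablaM) (hN : IsConnection dS N nablaN)
    (hM' : IsHorizontal τ M nablaM) (hN' : IsHorizontal τ N nablaN) (x : M.M) :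
    nablaN (f.toLin x) = f.toLin.rTensor Ω (nablaM x) := by
  -- The terms with `dS` in the two Leibniz rules cancel, so the defect of compatibility is linear.
  let B : M.M →ₗ[S] N.M ⊗[S] Ω :=
    { toFun := fun x => nablaN (f.toLin x) - f.toLin.rTensor Ω (nablaM x)
      map_add' := fun x y => by simp only [map_add]; abel
      map_smul' := fun s x => by
        rw [map_smul, hN, hM, map_add, map_smul, LinearMap.rTensor_tmul, RingHom.id_apply,
          smul_sub]
        abel }
  have hcomm : ∀ y : M.M ⊗[S] Ω, f.toLin.rTensor Ω (TensorProduct.map M.Φ τ y) =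
      TensorProduct.map N.Φ τ (f.toLin.rTensor Ω y) := by
    intro y
    induction y using TensorProduct.induction_on with
    | zero => simp
    | add x y hx hy => simp only [map_add, hx, hy]
    | tmul m ω => rw [TensorProduct.map_tmul, LinearMap.rTensor_tmul, LinearMap.rTensor_tmul,
        TensorProduct.map_tmul, f.map_Φ]
  have h := hF.eq_zero_of_horizontal 𝔫 hτ hτ₁ M N B (fun m => by
    change nablaN (f.toLin (M.Φ m)) - f.toLin.rTensor Ω (nablaM (M.Φ m)) = _
    rw [f.map_Φ, hN', hM', hcomm, ← map_sub]
    rfl)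
  exact sub_eq_zero.1 (LinearMap.congr_fun h x)

/-- Every window has a connection for which the Frobenius is horizontal. -/
theorem IsContracting.exists_connection {dS : S →+ Ω}
    (hdS : ∀ s t, dS (s * t) = s • dS t + t • dS s) (hdφ : ∀ s, dS (F.φ s) = τ (dS s))
    (M : Window.{u, w} F) :
    ∃ nabla : M.M →+ M.M ⊗[S] Ω, IsConnection dS M nabla ∧ IsHorizontal τ M nabla := by
  have := M.finite
  have := M.projective
  have : Module.Free S M.M := Module.free_of_flat_of_isLocalRing
  obtain ⟨Ψ, g, g', hg, hg', hgg', hspan⟩ := M.exists_normal_operator hF.φ_ϖ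
  let b := Module.Free.chooseBasis S M.M
  obtain ⟨b', hb'⟩ := exists_basis_of_span_range_eq_top b Ψ hspan
  let U := TensorProduct.map M.Φ τ₁
  have hbij := bijective_sub_semilinear p hF.torsionFree q hF.surjective 𝔫 hF.φ_ker hF.ne_zero
    hF.map_φ (twistOperator b b' g U) n
    (iterate_twistOperator_mem b b' g U _ n (iterate_map_tmul_mem hτ₁ M.Φ))
  -- The reference connection: the one that kills the basis `b`. It need not be horizontal.
  let nabla₀ : M.M →+ M.M ⊗[S] Ω :=
    { toFun := fun m => ∑ i, b i ⊗ₜ[S] dS (b.repr m i)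
      map_zero' := by simp
      map_add' := fun x y => by
        simp only [map_add, Finsupp.add_apply, TensorProduct.tmul_add, Finset.sum_add_distrib] }
  have hnabla₀ : IsConnection dS M nabla₀ := by
    intro s m
    change ∑ i, _ = s • ∑ i, _ + _
    conv_rhs => rw [← b.sum_repr m]
    rw [TensorProduct.sum_tmul, Finset.smul_sum, ← Finset.sum_add_distrib]
    refine Finset.sum_congr rfl fun i _ => ?_
    rw [map_smul, Finsupp.smul_apply, smul_eq_mul, hdS, TensorProduct.tmul_add,
      TensorProduct.tmul_smul, TensorProduct.smul_tmul, map_sum, Finsupp.finsetSum_apply]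
    simp [Finsupp.single_apply]
  -- The right-hand side measures by how much `nabla₀` fails to satisfy `∇ ∘ Ψ = U ∘ ∇ ∘ g` on the
  -- basis; surjectivity of `1 - T` supplies the linear correction.
  obtain ⟨v, hv⟩ := hbij.2 fun i => U (nabla₀ (g (b i))) - nabla₀ (Ψ (b i))
  let A := b'.constr S v
  have hA : ∀ i, A (Ψ (b i)) + nabla₀ (Ψ (b i)) = U (A (g (b i)) + nabla₀ (g (b i))) := by
    intro i
    have h := congrFun hv i
    simp only [Pi.sub_apply, twistOperator_apply] at h
    rw [← hb', b'.constr_basis, hb', map_add]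
    rw [sub_eq_sub_iff_add_eq_add] at h
    rw [h]
    exact add_comm _ _
  let nabla : M.M →+ M.M ⊗[S] Ω := A.toAddMonoidHom + nabla₀
  have hnabla : ∀ m, nabla m = A m + nabla₀ m := fun _ => rfl
  have hconn : IsConnection dS M nabla := by
    intro s m
    rw [hnabla, hnabla, map_smul, hnabla₀, smul_add]
    abel
  -- The identity extends from the basis to all `x` because the Leibniz terms agree: `Ψ x ⊗ dS(φ s)
  -- = Ψ x ⊗ p τ₁(dS s) = Φ(g x) ⊗ τ₁(dS s)`.
  have hΨ : ∀ x, nabla (Ψ x) = U (nabla (g x)) := by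
    intro x
    rw [← b.sum_repr x]
    simp only [map_sum, LinearMap.map_smulₛₗ, map_smul]
    refine Finset.sum_congr rfl fun i _ => ?_
    rw [hconn, hconn, map_add, TensorProduct.map_tmul, U.map_smulₛₗ, hg, hF.ϖ_eq,
      TensorProduct.smul_tmul, ← hτ, ← hdφ]
    congr 2
    exact hA i
  refine ⟨nabla, hconn, fun m => ?_⟩
  -- Since `Φ = Ψ ∘ g'` and `g ∘ g' = p`, the divided identity gives back horizontality: `∇(Φ m) =
  -- U(∇(p m)) = p U(∇ m)`.
  rw [← hg', hΨ, hgg', hF.ϖ_eq, map_eq_natCast_smul_map hτ, Nat.cast_smul_eq_nsmul,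
    map_nsmul, map_nsmul, Nat.cast_smul_eq_nsmul]

/-- Compatibility of homomorphisms with connections does double duty: for the identity of `M` it is
uniqueness, for a general homomorphism it is fullness. -/
theorem IsContracting.existsUnique_connection_and_isEquivalence {dS : S →+ Ω}
    (hdS : ∀ s t, dS (s * t) = s • dS t + t • dS s) (hdφ : ∀ s, dS (F.φ s) = τ (dS s)) :
    (∀ M : Window.{u, w} F, ∃! nabla : M.M →+ M.M ⊗[S] Ω,
      IsConnection dS M nabla ∧ IsHorizontal τ M nabla) ∧
    (forgetConn.{u, v, w} dS τ).IsEquivalence := by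
  refine ⟨fun M => ?_, ?_⟩
  · obtain ⟨nabla, h, h'⟩ := hF.exists_connection 𝔫 hτ hτ₁ hdS hdφ M
    refine ⟨nabla, ⟨h, h'⟩, fun nabla' h'' => ?_⟩
    ext x
    have := hF.map_nabla 𝔫 hτ hτ₁ (𝟙 M : M ⟶ M) h h''.1 h' h''.2 x
    exact this.trans (LinearMap.rTensor_id_apply Ω _ _)
  · have hfaith : (forgetConn.{u, v, w} dS τ).Faithful :=
      ⟨fun {_ _ f g} h => WindowConnHom.ext h⟩
    have hfull : (forgetConn.{u, v, w} dS τ).Full :=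
      ⟨fun {M N} f => ⟨⟨f, fun x => hF.map_nabla 𝔫 hτ hτ₁ f M.isConnection N.isConnection
        M.isHorizontal N.isHorizontal x⟩, rfl⟩⟩
    have hess : (forgetConn.{u, v, w} dS τ).EssSurj := ⟨fun M => by
      obtain ⟨nabla, h, h'⟩ := hF.exists_connection 𝔫 hτ hτ₁ hdS hdφ M
      exact ⟨⟨M, nabla, h, h'⟩, ⟨Iso.refl M⟩⟩⟩
    exact {}

end Contracting

/-! ### Order filtration on power series -/

section PowerSeries

variable {A : Type u} [CommRing A] {d : ℕ}

/-- Assign to each nonconstant monomial one variable dividing it and group the terms of `f`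
accordingly. Dividing a group by its variable lowers the order by at most one. -/
theorem exists_eq_sum_X_mul (N : ℕ) (f : MvPowerSeries (Fin d) A)
    (hf : ((N + 1 : ℕ) : ℕ∞) ≤ f.order) :
    ∃ g : Fin d → MvPowerSeries (Fin d) A, f = ∑ i, MvPowerSeries.X i * g i ∧
      ∀ i, (N : ℕ∞) ≤ (g i).order := by
  classical
  have hf' : ∀ m : Fin d →₀ ℕ, m.degree < N + 1 → MvPowerSeries.coeff m f = 0 := fun m hm =>
    MvPowerSeries.coeff_of_lt_order (lt_of_lt_of_le (by exact_mod_cast hm) hf)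
  have hex : ∀ m : Fin d →₀ ℕ, ∃ o : Option (Fin d), m ≠ 0 → ∃ i, o = some i ∧ m i ≠ 0 := by
    intro m
    by_cases hm : m = 0
    · exact ⟨none, fun h => (h hm).elim⟩
    · obtain ⟨i, hi⟩ : ∃ i, m i ≠ 0 := by
        by_contra! h
        exact hm (Finsupp.ext h)
      exact ⟨some i, fun _ => ⟨i, rfl, hi⟩⟩
  choose c hc using hex
  let g : Fin d → MvPowerSeries (Fin d) A := fun i m =>
    if c (m + Finsupp.single i 1) = some i
    then MvPowerSeries.coeff (m + Finsupp.single i 1) f else 0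
  have hg : ∀ i m, MvPowerSeries.coeff m (g i) = if c (m + Finsupp.single i 1) = some i
    then MvPowerSeries.coeff (m + Finsupp.single i 1) f else 0 := fun _ _ => rfl
  refine ⟨g, ?_, fun i => MvPowerSeries.nat_le_order fun m hm => ?_⟩
  · ext m
    rw [map_sum]
    by_cases hm : m = 0
    · subst hm
      rw [hf' 0 (by simp)]
      simp
    · obtain ⟨i, hi, him⟩ := hc m hm
      have hle : ∀ j, Finsupp.single j 1 ≤ m ↔ m j ≠ 0 := fun j => by
        rw [Finsupp.single_le_iff, Nat.one_le_iff_ne_zero]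
      rw [Finset.sum_eq_single i]
      · rw [MvPowerSeries.X_def, MvPowerSeries.coeff_monomial_mul, if_pos ((hle i).2 him), hg,
          Finsupp.sub_add_single_one_cancel him, if_pos hi, one_mul]
      · intro j _ hj
        rw [MvPowerSeries.X_def, MvPowerSeries.coeff_monomial_mul]
        split_ifs with h
        · rw [hg, Finsupp.sub_add_single_one_cancel ((hle j).1 h), if_neg, mul_zero]
          rw [hi]
          exact fun h => hj (Option.some_injective _ h).symm
        · rfl
      · simp
  · rw [hg]
    split_ifs
    · exact hf' _ (by rw [map_add, Finsupp.degree_single]; omega)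
    · rfl

theorem mem_span_X_pow_of_le_order (N : ℕ) (f : MvPowerSeries (Fin d) A)
    (hf : (N : ℕ∞) ≤ f.order) :
    f ∈ Ideal.span (Set.range (MvPowerSeries.X : Fin d → MvPowerSeries (Fin d) A)) ^ N := by
  induction N generalizing f with
  | zero => simp
  | succ N ih =>
    obtain ⟨g, rfl, hg⟩ := exists_eq_sum_X_mul N f hf
    refine Ideal.sum_mem _ fun i _ => ?_
    rw [pow_succ']
    exact Ideal.mul_mem_mul (Ideal.subset_span ⟨i, rfl⟩) (ih _ (hg i))

theorem mem_span_X_of_constantCoeff_eq_zero (f : MvPowerSeries (Fin d) A)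
    (hf : MvPowerSeries.constantCoeff f = 0) :
    f ∈ Ideal.span (Set.range (MvPowerSeries.X : Fin d → MvPowerSeries (Fin d) A)) := by
  have := mem_span_X_pow_of_le_order 1 f (by
    exact_mod_cast MvPowerSeries.one_le_order_iff_constCoeff_eq_zero.2 hf)
  rwa [pow_one] at this

theorem constantCoeff_eq_zero_of_mem_span_X {f : MvPowerSeries (Fin d) A}
    (hf : f ∈ Ideal.span (Set.range (MvPowerSeries.X : Fin d → MvPowerSeries (Fin d) A))) :
    MvPowerSeries.constantCoeff f = 0 := by
  refine (Ideal.span_le (I := RingHom.ker MvPowerSeries.constantCoeff)).2 ?_ hf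
  rintro _ ⟨i, rfl⟩
  simp

end PowerSeries

/-! ### The kernel of π is principal -/

section Principal

variable {p : ℕ} [Fact p.Prime] {k : Type u} [Field k] [CharP k p] [PerfectRing k p] {d : ℕ}

theorem exists_eq_p_mul_of_constantCoeff_eq_zero (w : WittVector p k)
    (hw : WittVector.constantCoeff w = 0) : ∃ y, w = p * y := by
  have : w ∈ RingHom.ker (WittVector.constantCoeff (p := p) (R := k)) := hw
  rw [WittVector.ker_constantCoeff] at this
  exact Ideal.mem_span_singleton.1 this

theorem maximalIdeal_PS : maximalIdeal (PS p k d) = RingHom.ker (toResidue p k d) := by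
  refine (IsLocalRing.eq_maximalIdeal ?_).symm
  refine RingHom.ker_isMaximal_of_surjective _ ?_
  intro x
  obtain ⟨w, hw⟩ := WittVector.constantCoeff_surjective p x
  refine ⟨MvPowerSeries.C w, ?_⟩
  simp [toResidue, hw]

theorem natCast_mem_maximalIdeal_PS : (p : PS p k d) ∈ maximalIdeal (PS p k d) := by
  rw [maximalIdeal_PS, RingHom.mem_ker, map_natCast, CharP.cast_eq_zero]

theorem X_mem_maximalIdeal_PS (i : Fin d) :
    (MvPowerSeries.X i : PS p k d) ∈ maximalIdeal (PS p k d) := by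
  rw [maximalIdeal_PS, RingHom.mem_ker]
  simp [toResidue]

variable {E : PS p k d} (hE : MvPowerSeries.constantCoeff E = p)
include hE

/-- If `f` has order at least `N` and its reduction modulo `p` has larger order, then `f` is
congruent modulo `E` to a power series of order at least `N + 1`. -/
theorem exists_sub_mul_order_succ_le (N : ℕ) (f : PS p k d) (hf : (N : ℕ∞) ≤ f.order)
    (hf' : ((N + 1 : ℕ) : ℕ∞) ≤ (MvPowerSeries.map WittVector.constantCoeff f).order) :
    ∃ h, ((N + 1 : ℕ) : ℕ∞) ≤ (f - E * h).order := by
  classical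
  have hex : ∀ m : Fin d →₀ ℕ, ∃ y, m.degree = N → MvPowerSeries.coeff m f = p * y := by
    intro m
    by_cases hm : m.degree = N
    · have h0 : WittVector.constantCoeff (MvPowerSeries.coeff m f) = 0 := by
        rw [← MvPowerSeries.coeff_map]
        refine MvPowerSeries.coeff_of_lt_order (lt_of_lt_of_le ?_ hf')
        rw [hm]
        exact_mod_cast Nat.lt_succ_self N
      obtain ⟨y, hy⟩ := exists_eq_p_mul_of_constantCoeff_eq_zero _ h0
      exact ⟨y, fun _ => hy⟩
    · exact ⟨0, fun h => (hm h).elim⟩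
  choose c hc using hex
  -- `h` is the degree-`N` part of `f` divided by `p`. As `E` has constant term `p`, the product `E
  -- * h` has the same degree-`N` part as `f`.
  let h : PS p k d := fun m => if m.degree = N then c m else 0
  have hh : ∀ m, MvPowerSeries.coeff m h = if m.degree = N then c m else 0 := fun _ => rfl
  have hhord : (N : ℕ∞) ≤ h.order := MvPowerSeries.nat_le_order fun m hm => by
    rw [hh, if_neg hm.ne]
  refine ⟨h, ?_⟩
  have hsplit : f - E * h = (f - MvPowerSeries.C (p : WittVector p k) * h) +
      (-(E - MvPowerSeries.C (p : WittVector p k)) * h) := by ring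
  rw [hsplit]
  refine le_trans (le_min ?_ ?_) MvPowerSeries.min_order_le_add
  · refine MvPowerSeries.nat_le_order fun m hm => ?_
    rw [map_sub, MvPowerSeries.coeff_C_mul, hh]
    split_ifs with hmN
    · rw [hc m hmN, sub_self]
    · rw [mul_zero, sub_zero]
      refine MvPowerSeries.coeff_of_lt_order (lt_of_lt_of_le ?_ hf)
      exact_mod_cast (by omega : m.degree < N)
  · refine le_trans ?_ MvPowerSeries.le_order_mul
    have h1 : (1 : ℕ∞) ≤ (-(E - MvPowerSeries.C (p : WittVector p k))).order := by
      rw [MvPowerSeries.one_le_order_iff_constCoeff_eq_zero]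
      simp [hE]
    rw [add_comm N 1]
    push_cast
    exact add_le_add h1 hhord

/-- If the reduction modulo `p` had larger order at every stage, repeated use of
`exists_sub_mul_order_succ_le` would make `f` congruent modulo `E` to series of arbitrarily high
order, and `f` would lie in `(E)` because the quotient is separated. The resulting representative
has the same order before and after reduction modulo `p`. -/
theorem exists_order_map_eq (f : PS p k d) (hf : f ∉ Ideal.span {E}) :
    ∃ (N : ℕ) (f' : PS p k d), f - f' ∈ Ideal.span {E} ∧ (N : ℕ∞) ≤ f'.order ∧
      (MvPowerSeries.map WittVector.constantCoeff f').order = N := by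
  by_contra! hcon
  have key : ∀ N : ℕ, ∃ f', f - f' ∈ Ideal.span {E} ∧ (N : ℕ∞) ≤ f'.order := by
    intro N
    induction N with
    | zero => exact ⟨f, by simp, by simp⟩
    | succ N ih =>
      obtain ⟨f', h1, h2⟩ := ih
      have h3 := hcon N f' h1 h2
      have h4 : (N : ℕ∞) < (MvPowerSeries.map WittVector.constantCoeff f').order :=
        lt_of_le_of_ne (h2.trans (MvPowerSeries.le_order_map _)) h3.symm
      obtain ⟨h, hh⟩ := exists_sub_mul_order_succ_le hE N f' h2 (by
        push_cast
        exact Order.add_one_le_of_lt h4)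
      refine ⟨_, ?_, hh⟩
      rw [← sub_add]
      exact add_mem h1 (Ideal.mem_span_singleton.2 ⟨h, rfl⟩)
  refine hf ?_
  rw [← Ideal.Quotient.eq_zero_iff_mem]
  refine IsHausdorff.haus (I := maximalIdeal (PS p k d)) inferInstance _ fun N => ?_
  obtain ⟨f', h1, h2⟩ := key N
  rw [SModEq.zero, Ideal.Quotient.eq.2 h1]
  have h3 : f' ∈ maximalIdeal (PS p k d) ^ N := by
    refine Ideal.pow_right_mono ?_ N (mem_span_X_pow_of_le_order N f' h2)
    rw [Ideal.span_le]
    rintro _ ⟨i, rfl⟩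
    exact X_mem_maximalIdeal_PS i
  have h4 : Ideal.Quotient.mk (Ideal.span {E}) f' =
      f' • (1 : PS p k d ⧸ Ideal.span {E}) := by
    conv_lhs => rw [← mul_one f', ← smul_eq_mul]
    rfl
  rw [h4]
  exact Submodule.smul_mem_smul h3 trivial

/-- Compare orders over `W(k)` and over `k`. Let `f'` and `g'` be representatives whose orders `N`
and `M` survive reduction, and suppose `f' g' = E h`. Over `W(k)` the series `E` has order 0, so `h`
has order at least `N + M`. Over `k` it has positive order, so the product would have order above `N
+ M`, a contradiction. -/
theorem isPrime_span_of_constantCoeff_eq : (Ideal.span {E}).IsPrime := by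
  have hp0 : (p : WittVector p k) ≠ 0 := WittVector.p_nonzero p k
  constructor
  · rw [Ne, Ideal.span_singleton_eq_top, MvPowerSeries.isUnit_iff_constantCoeff, hE]
    exact (WittVector.irreducible p).1
  · intro f g hfg
    by_contra! hcon
    obtain ⟨N, f', h1, h2, h3⟩ := exists_order_map_eq hE f hcon.1
    obtain ⟨M, g', h1', h2', h3'⟩ := exists_order_map_eq hE g hcon.2
    have hmem : f' * g' ∈ Ideal.span {E} := by
      have : f' * g' = f * g - ((f - f') * g + f' * (g - g')) := by ring
      rw [this]
      exact sub_mem hfg (add_mem (Ideal.mul_mem_right _ _ h1) (Ideal.mul_mem_left _ _ h1'))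
    obtain ⟨h, hh⟩ := Ideal.mem_span_singleton.1 hmem
    have hE0 : E.order = 0 := by
      by_contra h
      exact hp0 (hE ▸ MvPowerSeries.order_ne_zero_iff_constCoeff_eq_zero.1 h)
    have hord : ((N + M : ℕ) : ℕ∞) ≤ h.order := by
      have h5 := congrArg MvPowerSeries.order hh
      rw [MvPowerSeries.order_mul, MvPowerSeries.order_mul, hE0, zero_add] at h5
      rw [← h5]
      push_cast
      exact add_le_add h2 h2'
    have h6 := congrArg (fun z => (MvPowerSeries.map WittVector.constantCoeff z).order) hh
    simp only [map_mul, MvPowerSeries.order_mul, h3, h3'] at h6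
    have h7 : (1 : ℕ∞) ≤ (MvPowerSeries.map WittVector.constantCoeff E).order := by
      rw [MvPowerSeries.one_le_order_iff_constCoeff_eq_zero, MvPowerSeries.constantCoeff_map, hE,
        map_natCast, CharP.cast_eq_zero]
    have h8 : ((N + M : ℕ) : ℕ∞) ≤ (MvPowerSeries.map WittVector.constantCoeff h).order :=
      hord.trans (MvPowerSeries.le_order_map _)
    have h9 := add_le_add h7 h8
    rw [← h6] at h9
    norm_cast at h9
    omega

/-- Modulo `E` the element `p` is a combination of the variables, so the `d` variables generate the
maximal ideal, and the number of generators bounds the dimension. -/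
theorem ringKrullDim_quotient_le : ringKrullDim (PS p k d ⧸ Ideal.span {E}) ≤ d := by
  have := isPrime_span_of_constantCoeff_eq hE
  let mkE := Ideal.Quotient.mk (Ideal.span {E})
  have : IsLocalRing (PS p k d ⧸ Ideal.span {E}) :=
    IsLocalRing.of_surjective' mkE Ideal.Quotient.mk_surjective
  refine (ringKrullDim_le_spanFinrank_maximalIdeal _).trans ?_
  have hmax : maximalIdeal (PS p k d ⧸ Ideal.span {E}) =
      Ideal.span (Set.range fun i => mkE (MvPowerSeries.X i)) := by
    have hloc : IsLocalHom mkE := IsLocalHom.of_surjective mkE Ideal.Quotient.mk_surjective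
    refine le_antisymm ?_ ?_
    · intro x hx
      obtain ⟨f, rfl⟩ := Ideal.Quotient.mk_surjective x
      have hf : f ∈ maximalIdeal (PS p k d) := fun hu => hx (hu.map mkE)
      rw [maximalIdeal_PS] at hf
      obtain ⟨y, hy⟩ := exists_eq_p_mul_of_constantCoeff_eq_zero
        (MvPowerSeries.constantCoeff f) hf
      have h1 : f - MvPowerSeries.C y * E ∈ Ideal.span (Set.range MvPowerSeries.X) :=
        mem_span_X_of_constantCoeff_eq_zero _ (by simp [hE, hy, mul_comm])
      have h2 := Ideal.mem_map_of_mem mkE h1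
      rw [Ideal.map_span, ← Set.range_comp, map_sub, map_mul,
        show mkE E = 0 from Ideal.Quotient.eq_zero_iff_mem.2 (Ideal.mem_span_singleton_self E),
        mul_zero, sub_zero] at h2
      exact h2
    · rw [Ideal.span_le]
      rintro _ ⟨i, rfl⟩
      exact fun hu => X_mem_maximalIdeal_PS i (isUnit_of_map_unit mkE _ hu)
  rw [hmax]
  have h1 := Submodule.spanFinrank_span_le_ncard_of_finite (R := PS p k d ⧸ Ideal.span {E})
    (Set.finite_range fun i : Fin d => mkE (MvPowerSeries.X i))
  have h2 : (Set.range fun i : Fin d => mkE (MvPowerSeries.X i)).ncard ≤ d := by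
    rw [← Set.image_univ]
    refine (Set.ncard_image_le Set.finite_univ).trans ?_
    rw [Set.ncard_univ, Nat.card_eq_fintype_card, Fintype.card_fin]
  exact_mod_cast h1.trans h2

omit hE in
/-- The kernel of a surjective map from `W(k)[[u_1, …, u_d]]` to a `d`-dimensional local domain
whose maximal ideal is generated by the images of the variables is principal. -/
theorem exists_ker_eq_span {R : Type v} [CommRing R] [IsLocalRing R]
    [CharP (ResidueField R) p] (hd : ringKrullDim R = d) (π : PS p k d →+* R)
    (hπ : Function.Surjective π)
    (hπu : Ideal.span (Set.range fun i => π (MvPowerSeries.X i)) = maximalIdeal R) :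
    ∃ E, RingHom.ker π = Ideal.span {E} ∧ E ≠ 0 := by
  have hpR : (p : R) ∈ maximalIdeal R := by
    rw [← IsLocalRing.residue_eq_zero_iff, map_natCast, CharP.cast_eq_zero]
  have hmap : Ideal.map π (Ideal.span (Set.range MvPowerSeries.X)) = maximalIdeal R := by
    rw [Ideal.map_span, ← Set.range_comp, ← hπu]
    rfl
  rw [← hmap, Ideal.mem_map_iff_of_surjective π hπ] at hpR
  -- As `p` lies in the maximal ideal of `R`, it is the image of some `e` in the ideal of the
  -- variables; the generator will be `p - e`.
  obtain ⟨e, he, hπe⟩ := hpR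
  have hE : MvPowerSeries.constantCoeff ((p : PS p k d) - e) = p := by
    rw [map_sub, map_natCast, constantCoeff_eq_zero_of_mem_span_X he, sub_zero]
  have hπE : π (p - e) = 0 := by rw [map_sub, map_natCast, hπe, sub_self]
  refine ⟨p - e, le_antisymm ?_ ?_, ?_⟩
  -- A larger kernel would contain an element that is nonzero in the domain `𝔖/(E)`. Dividing by it
  -- drops the dimension below `d`, yet the quotient still surjects onto `R`.
  · by_contra hle
    obtain ⟨f, hf, hfE⟩ := Set.not_subset.1 hle
    have := isPrime_span_of_constantCoeff_eq hE
    have hnzd : Ideal.Quotient.mk (Ideal.span {(p : PS p k d) - e}) f ∈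
        nonZeroDivisors (PS p k d ⧸ Ideal.span {(p : PS p k d) - e}) := by
      refine mem_nonZeroDivisors_of_ne_zero ?_
      rw [Ne, Ideal.Quotient.eq_zero_iff_mem]
      exact hfE
    have h1 := ringKrullDim_quotient_succ_le_of_nonZeroDivisor hnzd
    have h2 := ringKrullDim_quotient_le hE
    let g : PS p k d ⧸ Ideal.span {(p : PS p k d) - e} →+* R :=
      Ideal.Quotient.lift _ π fun a ha => by
        obtain ⟨c, rfl⟩ := Ideal.mem_span_singleton.1 ha
        rw [map_mul, hπE, zero_mul]
    let g' : (PS p k d ⧸ Ideal.span {(p : PS p k d) - e}) ⧸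
        Ideal.span {Ideal.Quotient.mk (Ideal.span {(p : PS p k d) - e}) f} →+* R :=
      Ideal.Quotient.lift _ g fun a ha => by
        obtain ⟨c, rfl⟩ := Ideal.mem_span_singleton.1 ha
        rw [map_mul, show g (Ideal.Quotient.mk _ f) = 0 from hf, zero_mul]
    have hg' : Function.Surjective g' := fun r => by
      obtain ⟨a, rfl⟩ := hπ r
      exact ⟨Ideal.Quotient.mk _ (Ideal.Quotient.mk _ a), rfl⟩
    have h3 : ringKrullDim R ≤ ringKrullDim ((PS p k d ⧸ Ideal.span {(p : PS p k d) - e}) ⧸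
        Ideal.span {Ideal.Quotient.mk (Ideal.span {(p : PS p k d) - e}) f}) :=
      ringKrullDim_le_of_surjective g' hg'
    rw [hd] at h3
    have h4 : ((d : WithBot ℕ∞) + 1) ≤ d :=
      (add_le_add_left h3 1).trans (h1.trans h2)
    have h5 : d + 1 ≤ d := by exact_mod_cast h4
    omega
  · rw [Ideal.span_le, Set.singleton_subset_iff]
    exact hπE
  · intro h0
    rw [h0, map_zero] at hE
    exact WittVector.p_nonzero p k hE.symm

end Principal

/-! ### Frobenius lifts and the universal derivation -/

section Differential

variable {p : ℕ} [Fact p.Prime] {k : Type u} [Field k] [CharP k p] [PerfectRing k p] {d : ℕ}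

/-- Perfectness of `k` enters here: the residue has a `p`-th root, and the remaining error is
divisible by `p`. -/
theorem exists_eq_pow_add_p_mul (w : WittVector p k) : ∃ x y, w = x ^ p + p * y := by
  obtain ⟨a, ha⟩ := surjective_frobenius k p (WittVector.constantCoeff w)
  obtain ⟨x, hx⟩ := WittVector.constantCoeff_surjective p a
  obtain ⟨y, hy⟩ := exists_eq_p_mul_of_constantCoeff_eq_zero (w - x ^ p) (by
    rw [map_sub, map_pow, hx, ← ha, frobenius_def, sub_self])
  exact ⟨x, y, by rw [← hy]; ring⟩

/-- Every element of `𝔖` has the form `x ^ p + p y + ∑ u_i g_i`. -/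
theorem exists_eq_pow_add_p_mul_add_sum (f : PS p k d) :
    ∃ (x y : PS p k d) (g : Fin d → PS p k d),
      f = x ^ p + p * y + ∑ i, MvPowerSeries.X i * g i := by
  obtain ⟨x, y, hxy⟩ := exists_eq_pow_add_p_mul (MvPowerSeries.constantCoeff f)
  obtain ⟨g, hg, -⟩ := exists_eq_sum_X_mul 0
    (f - MvPowerSeries.C (MvPowerSeries.constantCoeff f)) (by
      rw [zero_add, Nat.cast_one, MvPowerSeries.one_le_order_iff_constCoeff_eq_zero]
      simp)
  refine ⟨MvPowerSeries.C x, MvPowerSeries.C y, g, ?_⟩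
  rw [← hg, hxy]
  simp

omit [CharP k p] [PerfectRing k p] in
theorem univD_X (i : Fin d) :
    univD p k d (MvPowerSeries.X i) = Pi.single i 1 := by
  funext j
  change MvPowerSeries.pderiv _ j (MvPowerSeries.X i) = _
  rw [MvPowerSeries.pderiv_X, Pi.single_apply, Pi.single_apply]
  simp only [eq_comm]

/-- The endomorphism `φ` is compatible with the universal derivation: `d ∘ φ = dφ ∘ d`. -/
theorem univD_map {φ : PS p k d →+* PS p k d} (hφ : IsFrobeniusLift φ) (a : PS p k d) :
    univD p k d (φ a) = dPhi φ (univD p k d a) := by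
  -- The defect `δ` is a derivation over `φ` that kills the variables, and `δ(x ^ p)` is a multiple
  -- of `p`. Decomposing elements as `x ^ p + p y + ∑ uᵢ gᵢ` shows that the span of its values
  -- equals its product with the maximal ideal, so Nakayama's lemma applies. No continuity of `φ`
  -- has to be invoked.
  let δ : PS p k d →+ Omega p k d :=
    (univD p k d).toLinearMap.toAddMonoidHom.comp φ.toAddMonoidHom -
      (dPhi φ).toAddMonoidHom.comp (univD p k d).toLinearMap.toAddMonoidHom
  have hδ : ∀ a, δ a = univD p k d (φ a) - dPhi φ (univD p k d a) := fun _ => rfl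
  have hmul : ∀ a b, δ (a * b) = φ a • δ b + φ b • δ a := by
    intro a b
    simp only [hδ, map_mul, Derivation.leibniz, map_add, LinearMap.map_smulₛₗ, smul_sub]
    abel
  have hpow : ∀ a, δ (a ^ p) = (p : PS p k d) • φ a ^ (p - 1) • δ a := by
    intro a
    simp only [hδ, map_pow, Derivation.leibniz_pow, map_nsmul, LinearMap.map_smulₛₗ, smul_sub,
      Nat.cast_smul_eq_nsmul]
  have hX : ∀ i, δ (MvPowerSeries.X i) = 0 := by
    intro i
    rw [hδ, univD_X, sub_eq_zero]
    change _ = ∑ j : Fin d, φ _ • univD p k d (φ (MvPowerSeries.X j))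
    rw [Finset.sum_eq_single i]
    · simp
    · intro j _ hj
      rw [Pi.single_eq_of_ne hj, map_zero, zero_smul]
    · simp
  let N := Submodule.span (PS p k d) (Set.range δ)
  have hN : ∀ a, δ a ∈ N := fun a => Submodule.subset_span ⟨a, rfl⟩
  have hφX : ∀ i, φ (MvPowerSeries.X i) ∈ maximalIdeal (PS p k d) := by
    intro i
    have h1 : φ (MvPowerSeries.X i) - MvPowerSeries.X i ^ p ∈ maximalIdeal (PS p k d) := by
      obtain ⟨c, hc⟩ := Ideal.mem_span_singleton.1 (hφ (MvPowerSeries.X i))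
      rw [hc]
      exact Ideal.mul_mem_right _ _ natCast_mem_maximalIdeal_PS
    have h2 := Ideal.pow_mem_of_mem _ (X_mem_maximalIdeal_PS (p := p) (k := k) i) p
      (Nat.Prime.pos Fact.out)
    simpa using add_mem h1 h2
  have hle : N ≤ maximalIdeal (PS p k d) • N := by
    rw [Submodule.span_le]
    rintro _ ⟨f, rfl⟩
    obtain ⟨x, y, g, rfl⟩ := exists_eq_pow_add_p_mul_add_sum f
    rw [map_add, map_add, hpow, map_sum, ← nsmul_eq_mul, map_nsmul,
      ← Nat.cast_smul_eq_nsmul (PS p k d)]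
    refine add_mem (add_mem ?_ ?_) (sum_mem fun i _ => ?_)
    · exact Submodule.smul_mem_smul natCast_mem_maximalIdeal_PS (Submodule.smul_mem _ _ (hN x))
    · exact Submodule.smul_mem_smul natCast_mem_maximalIdeal_PS (hN y)
    · rw [hmul, hX, smul_zero, add_zero]
      exact Submodule.smul_mem_smul (hφX i) (hN _)
  have hbot := Submodule.eq_bot_of_le_smul_of_le_jacobson_bot _ N (IsNoetherian.noetherian N) hle
    (IsLocalRing.maximalIdeal_le_jacobson ⊥)
  have h0 := hN a
  rw [hbot, Submodule.mem_bot, hδ, sub_eq_zero] at h0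
  exact h0

end Differential

/-! ### Divisibility of p ^ n / n! -/

section Factorial

/-- In a `p`-local ring, `p ^ n / n!` is defined and divisible by `p` for `n ≥ 1`. -/
theorem exists_factorial_mul_p_mul_eq (p : ℕ) [Fact p.Prime] {A : Type u} [CommRing A]
    (hA : ∀ m : ℕ, ¬ p ∣ m → IsUnit (m : A)) {n : ℕ} (hn : n ≠ 0) :
    ∃ c : A, (n.factorial : A) * (p * c) = (p : A) ^ n := by
  obtain ⟨e, m, hm, h⟩ := Nat.exists_eq_pow_mul_and_not_dvd n.factorial_ne_zero p
    (Nat.Prime.ne_one Fact.out)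
  have he : e < n := by
    -- By Legendre's formula `(p - 1) v_p(n!)` is less than `n`, which leaves one spare factor `p`.
    have h1 := sub_one_mul_padicValNat_factorial_lt_of_ne_zero (p := p) hn
    have h2 : e ≤ padicValNat p n.factorial := by
      rw [← padicValNat_dvd_iff_le n.factorial_ne_zero, h]
      exact dvd_mul_right _ _
    have h3 : 1 ≤ p - 1 := Nat.le_sub_one_of_lt (Nat.Prime.one_lt Fact.out)
    nlinarith
  obtain ⟨v, hv⟩ := (hA m hm).exists_right_inv
  refine ⟨v * (p : A) ^ (n - e - 1), ?_⟩
  rw [h]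
  push_cast
  calc (p : A) ^ e * m * (p * (v * (p : A) ^ (n - e - 1)))
      = (m * v) * (p : A) ^ (e + (1 + (n - e - 1))) := by ring
    _ = _ := by rw [hv, one_mul]; congr 1; omega

end Factorial

/-! ### Frobenius on the divided power envelope -/

section PDEnvelope

variable {p : ℕ} {A : Type u} [CommRing A] {J : Ideal A}

theorem PDEnv.induction {P : PDEnv p J → Prop} (z : PDEnv p J)
    (h_alg : ∀ a, P (algebraMap A _ a)) (h_sum : ∀ z w, P z → P w → P (z + w))
    (h_mul : ∀ z n x, P z → P (z * pdPow p J n x)) : P z := by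
  obtain ⟨y, rfl⟩ := Ideal.Quotient.mk_surjective z
  change P (pdMk p J y)
  induction y using DividedPowerAlgebra.induction_on with
  | C a => exact h_alg a
  | add f g hf hg => rw [map_add]; exact h_sum _ _ hf hg
  | dp f n x hf => rw [map_mul]; exact h_mul _ n x hf

theorem factorial_mul_pdPow (n : ℕ) (x : pdIdeal p J) :
    (n.factorial : PDEnv p J) * pdPow p J n x = algebraMap A _ (x : A) ^ n := by
  have h := congrArg (pdMk p J) (DividedPowerAlgebra.natFactorial_mul_dp_eq (R := A) n x)
  rw [map_mul, map_natCast, map_pow] at h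
  rw [← pdPow_one]
  exact h

variable [Fact p.Prime]

/-- The power equals `(pn)! / (n!) ^ p` times `x^{[pn]}`, and this coefficient is `p!` times the
number of partitions of a set of `pn` elements into `p` blocks of size `n`. -/
theorem p_dvd_pdPow_pow {n : ℕ} (hn : n ≠ 0) (x : pdIdeal p J) :
    (p : PDEnv p J) ∣ pdPow p J n x ^ p := by
  have h := congrArg (pdMk p J) (DividedPowerAlgebra.pow_dp (R := A) n x p)
  rw [map_mul, map_natCast, map_pow] at h
  have h1 : p ∣ Multiset.multinomial (p • {n}) := by
    rw [Multiset.multinomial_nsmul_singleton]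
    have h2 := Nat.uniformBell_mul_eq p hn
    have h3 := Nat.multinomial_spec (Finset.range p) (fun _ => n)
    simp only [Finset.prod_const, Finset.card_range, Finset.sum_const, smul_eq_mul] at h3
    rw [← h2, mul_comm (p.uniformBell n), mul_assoc] at h3
    have h4 := Nat.eq_of_mul_eq_mul_left (pow_pos n.factorial_pos p) h3
    rw [h4]
    exact Dvd.dvd.mul_left (Nat.dvd_factorial (Nat.Prime.pos Fact.out) le_rfl) _
  change pdPow p J n x ^ p = _ at h
  rw [h]
  exact Dvd.dvd.mul_right (by exact_mod_cast Nat.cast_dvd_cast h1) _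

omit [Fact p.Prime] in
/-- If all divided powers of `x` and `y` are divisible by `p`, then so are those of `x + y`. -/
theorem p_dvd_pdPow_add {x y : pdIdeal p J} (hx : ∀ n ≠ 0, (p : PDEnv p J) ∣ pdPow p J n x)
    (hy : ∀ n ≠ 0, (p : PDEnv p J) ∣ pdPow p J n y) (n : ℕ) (hn : n ≠ 0) :
    (p : PDEnv p J) ∣ pdPow p J n (x + y) := by
  rw [pdPow_add]
  refine Finset.dvd_sum fun k hk => ?_
  rw [Finset.HasAntidiagonal.mem_antidiagonal] at hk
  by_cases h : k.1 = 0
  · exact Dvd.dvd.mul_left (hy _ (by omega)) _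
  · exact Dvd.dvd.mul_right (hx _ h) _

/-- The divided power is `x ^ (n(p-1)) x^{[n]}`, which equals `(n(p-1))!` times a binomial
coefficient times `x^{[np]}`. For `n ≥ 2` the factorial contains `p`; for `n = 1` the binomial
coefficient is `p`. -/
theorem p_dvd_pdPow_pow_smul (x : pdIdeal p J) (n : ℕ) (hn : n ≠ 0) :
    (p : PDEnv p J) ∣ pdPow p J n ((x : A) ^ (p - 1) • x) := by
  have hp1 : 2 ≤ p := Nat.Prime.two_le Fact.out
  rw [pdPow_smul, map_pow, ← pow_mul, ← factorial_mul_pdPow, mul_assoc, pdPow_mul, nsmul_eq_mul,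
    ← mul_assoc]
  refine Dvd.dvd.mul_right ?_ _
  rw [← Nat.cast_mul]
  refine Nat.cast_dvd_cast ?_
  rcases Nat.lt_or_ge n 2 with h | h
  · obtain rfl : n = 1 := by omega
    rw [mul_one, Nat.sub_add_cancel (by omega), Nat.choose_symm (by omega : 1 ≤ p),
      Nat.choose_one_right]
    exact dvd_mul_left _ _
  · refine Dvd.dvd.mul_right (Nat.dvd_factorial (Nat.Prime.pos Fact.out) ?_) _
    obtain ⟨q, rfl⟩ : ∃ q, p = q + 2 := ⟨p - 2, by omega⟩
    rw [show q + 2 - 1 = q + 1 by omega]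
    nlinarith

variable (hA : ∀ m : ℕ, ¬ p ∣ m → IsUnit (m : A))
include hA

theorem pdPow_smul_pElt_of_ne_zero (t : A) (n : ℕ) (hn : n ≠ 0) :
    ∃ c : A, pdPow p J n (t • pElt p J) = algebraMap A _ (p * c) := by
  obtain ⟨c, hc⟩ := exists_factorial_mul_p_mul_eq p hA hn
  refine ⟨t ^ n * c, ?_⟩
  rw [pdPow_smul, pdPow_p p J n _ hc, ← map_pow, ← map_mul]
  congr 1
  ring

theorem p_dvd_pdPow_smul_pElt (t : A) (n : ℕ) (hn : n ≠ 0) :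
    (p : PDEnv p J) ∣ pdPow p J n (t • pElt p J) := by
  obtain ⟨c, hc⟩ := pdPow_smul_pElt_of_ne_zero (J := J) hA t n hn
  rw [hc, map_mul, map_natCast]
  exact dvd_mul_right _ _

variable {φ : A →+* A} (hφ : ∀ a, φ a - a ^ p ∈ Ideal.span {(p : A)})
  (hφJ : ∀ x ∈ pdIdeal p J, φ x ∈ pdIdeal p J)
include hφ

omit [Fact p.Prime] hA hφ in
theorem pdPhi_pdPow (n : ℕ) (x : pdIdeal p J) :
    pdPhi p J φ hφJ (pdPow p J n x) = pdPow p J n ⟨φ x, hφJ x x.2⟩ := by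
  rw [pdPhi, pdLift_pdPow]

/-- Write `φ(x) = x ^ (p-1) · x + t p`. The positive divided powers of both summands are divisible
by `p`, hence so are those of the sum. -/
theorem p_dvd_pdPhi_pdPow (n : ℕ) (hn : n ≠ 0) (x : pdIdeal p J) :
    (p : PDEnv p J) ∣ pdPhi p J φ hφJ (pdPow p J n x) := by
  obtain ⟨t, ht⟩ := Ideal.mem_span_singleton.1 (hφ x)
  have h : (⟨φ x, hφJ x x.2⟩ : pdIdeal p J) = (x : A) ^ (p - 1) • x + t • pElt p J := by
    refine Subtype.ext ?_
    change φ x = (x : A) ^ (p - 1) * x + t * p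
    rw [← pow_succ, Nat.sub_add_cancel (Nat.Prime.one_le Fact.out), mul_comm t, ← ht]
    ring
  rw [pdPhi_pdPow, h]
  exact p_dvd_pdPow_add (p_dvd_pdPow_pow_smul x) (p_dvd_pdPow_smul_pElt hA t) n hn

/-- The extension of `φ` to the divided power envelope is a lift of Frobenius. -/
theorem p_dvd_pdPhi_sub_pow (z : PDEnv p J) : (p : PDEnv p J) ∣ pdPhi p J φ hφJ z - z ^ p := by
  induction z using PDEnv.induction with
  | h_alg a =>
    obtain ⟨t, ht⟩ := Ideal.mem_span_singleton.1 (hφ a)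
    rw [pdPhi_algebraMap, ← map_pow, ← map_sub, ht, map_mul, map_natCast]
    exact dvd_mul_right _ _
  | h_sum z w hz hw =>
    obtain ⟨r, hr⟩ := exists_add_pow_prime_eq (Fact.out : p.Prime) z w
    have : pdPhi p J φ hφJ (z + w) - (z + w) ^ p = (pdPhi p J φ hφJ z - z ^ p) +
        (pdPhi p J φ hφJ w - w ^ p) - p * (z * w * r) := by
      rw [hr, map_add]
      ring
    rw [this]
    exact dvd_sub (dvd_add hz hw) (dvd_mul_right _ _)
  | h_mul z n x hz =>
    by_cases hn : n = 0
    · subst hn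
      rwa [pdPow_zero, mul_one]
    · rw [map_mul, mul_pow]
      exact dvd_sub (Dvd.dvd.mul_left (p_dvd_pdPhi_pdPow hA hφ hφJ n hn x) _)
        (Dvd.dvd.mul_left (p_dvd_pdPow_pow hn x) _)

omit [Fact p.Prime] hA hφ in
/-- The divided power envelope is the sum of the image of `A` and any ideal that contains the
divided powers of positive degree. -/
theorem PDEnv.exists_eq_algebraMap_add {I : Ideal (PDEnv p J)}
    (hI : ∀ n ≠ 0, ∀ x, pdPow p J n x ∈ I) (z : PDEnv p J) :
    ∃ a : A, z - algebraMap A _ a ∈ I := by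
  induction z using PDEnv.induction with
  | h_alg a => exact ⟨a, by simp⟩
  | h_sum z w hz hw =>
    obtain ⟨a, ha⟩ := hz
    obtain ⟨b, hb⟩ := hw
    refine ⟨a + b, ?_⟩
    rw [map_add, add_sub_add_comm]
    exact add_mem ha hb
  | h_mul z n x hz =>
    by_cases hn : n = 0
    · subst hn
      rwa [pdPow_zero, mul_one]
    · exact ⟨0, by simpa using Ideal.mul_mem_left _ _ (hI n hn x)⟩

end PDEnvelope

/-! ### The envelope of a principal ideal is p-torsion free -/

section TorsionFree

variable {p : ℕ} [Fact p.Prime] {A : Type u} [CommRing A] [IsDomain A] [CharZero A] {J : Ideal A}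

variable (p J) in
/-- The map from the divided power envelope to the fraction field, `x^{[n]} ↦ x ^ n / n!`. -/
def pdToFractionRing : PDEnv p J →+* FractionRing A :=
  pdLift p J (algebraMap A (FractionRing A))
    (fun n x => algebraMap A (FractionRing A) x ^ n / (n.factorial : FractionRing A))
    (fun x => by simp) (fun x => by simp)
    (fun n c hc => by
      have h : (n.factorial : FractionRing A) ≠ 0 := Nat.cast_ne_zero.2 n.factorial_ne_zero
      rw [div_eq_iff h, ← map_natCast (algebraMap A (FractionRing A)), ← map_mul, mul_comm c, hc,
        map_pow]
      rfl)
    (fun n r x => by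
      change algebraMap A (FractionRing A) (r * x) ^ n / _ = _
      rw [map_mul, mul_pow, mul_div_assoc])
    (fun n m x => by
      have h1 : (n.factorial : FractionRing A) ≠ 0 := Nat.cast_ne_zero.2 n.factorial_ne_zero
      have h2 : (m.factorial : FractionRing A) ≠ 0 := Nat.cast_ne_zero.2 m.factorial_ne_zero
      have h3 : ((n + m).factorial : FractionRing A) ≠ 0 :=
        Nat.cast_ne_zero.2 (n + m).factorial_ne_zero
      have h4 : ((n + m).choose n : FractionRing A) * n.factorial * m.factorial =
          (n + m).factorial := by
        rw [Nat.choose_symm_add]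
        exact_mod_cast Nat.add_choose_mul_factorial_mul_factorial n m
      rw [nsmul_eq_mul, ← h4]
      rw [← h4] at h3
      have h5 : ((n + m).choose n : FractionRing A) ≠ 0 := by
        intro h
        rw [h] at h3
        simp at h3
      field_simp
      ring)
    (fun n x y => by
      have h0 : (n.factorial : FractionRing A) ≠ 0 := Nat.cast_ne_zero.2 n.factorial_ne_zero
      change algebraMap A (FractionRing A) (x + y) ^ n / _ = _
      rw [map_add, (Commute.all (algebraMap A (FractionRing A) x) _).add_pow', Finset.sum_div]
      refine Finset.sum_congr rfl fun k hk => ?_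
      rw [Finset.HasAntidiagonal.mem_antidiagonal] at hk
      subst hk
      have h1 : (k.1.factorial : FractionRing A) ≠ 0 := Nat.cast_ne_zero.2 k.1.factorial_ne_zero
      have h2 : (k.2.factorial : FractionRing A) ≠ 0 := Nat.cast_ne_zero.2 k.2.factorial_ne_zero
      have h4 : ((k.1 + k.2).choose k.1 : FractionRing A) * k.1.factorial * k.2.factorial =
          (k.1 + k.2).factorial := by
        rw [Nat.choose_symm_add]
        exact_mod_cast Nat.add_choose_mul_factorial_mul_factorial k.1 k.2
      rw [nsmul_eq_mul, div_mul_div_comm, div_eq_div_iff h0 (mul_ne_zero h1 h2), ← h4]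
      ring)

omit [Fact p.Prime] in
theorem pdToFractionRing_algebraMap (a : A) :
    pdToFractionRing p J (algebraMap A _ a) = algebraMap A (FractionRing A) a :=
  pdLift_algebraMap ..

omit [Fact p.Prime] in
theorem pdToFractionRing_pdPow (n : ℕ) (x : pdIdeal p J) :
    pdToFractionRing p J (pdPow p J n x) =
      algebraMap A (FractionRing A) x ^ n / (n.factorial : FractionRing A) :=
  pdLift_pdPow ..

omit [CharZero A] [IsDomain A] in
/-- The divided power envelope of a principal ideal is spanned by the divided powers of a
generator. -/
theorem PDEnv.mem_span_pdPow (hA : ∀ m : ℕ, ¬ p ∣ m → IsUnit (m : A)) (E : pdIdeal p J)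
    (hJ : J = Ideal.span {(E : A)}) (z : PDEnv p J) :
    z ∈ Submodule.span A (Set.range fun n => pdPow p J n E) := by
  let Y := Submodule.span A (Set.range fun n => pdPow p J n E)
  have hY : ∀ n, pdPow p J n E ∈ Y := fun n => Submodule.subset_span ⟨n, rfl⟩
  have hmulE : ∀ n, ∀ y ∈ Y, y * pdPow p J n E ∈ Y := by
    intro n y hy
    induction hy using Submodule.span_induction with
    | mem y hy =>
      obtain ⟨m, rfl⟩ := hy
      change pdPow p J m E * _ ∈ _
      rw [pdPow_mul]
      exact nsmul_mem (hY _) _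
    | zero => rw [zero_mul]; exact zero_mem _
    | add x y _ _ hx hy => rw [add_mul]; exact add_mem hx hy
    | smul a x _ hx => rw [smul_mul_assoc]; exact Submodule.smul_mem _ _ hx
  have hA' : ∀ (t : A) (n : ℕ), ∃ c : A, pdPow p J n (t • pElt p J) = algebraMap A _ c := by
    intro t n
    by_cases hn : n = 0
    · exact ⟨1, by rw [hn, pdPow_zero, map_one]⟩
    · obtain ⟨c, hc⟩ := pdPow_smul_pElt_of_ne_zero (J := J) hA t n hn
      exact ⟨_, hc⟩
  have halg : ∀ (c : A), ∀ y ∈ Y, y * algebraMap A _ c ∈ Y := by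
    intro c y hy
    rw [mul_comm, ← Algebra.smul_def]
    exact Submodule.smul_mem _ _ hy
  change z ∈ Y
  induction z using PDEnv.induction with
  | h_alg a =>
    have h := halg a _ (hY 0)
    rwa [pdPow_zero, one_mul] at h
  | h_sum z w hz hw => exact add_mem hz hw
  | h_mul z n x hz =>
    obtain ⟨y, hy, s, hs, hys⟩ := Submodule.mem_sup.1 x.2
    rw [hJ] at hy
    obtain ⟨r, rfl⟩ := Ideal.mem_span_singleton.1 hy
    obtain ⟨t, rfl⟩ := Ideal.mem_span_singleton.1 hs
    -- The divided powers of `t p` are scalars from `A`, so only those of `E` survive in the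
    -- expansion.
    have hx : x = r • E + t • pElt p J := by
      refine Subtype.ext ?_
      rw [← hys]
      change _ = r * (E : A) + t * p
      ring
    rw [hx, pdPow_add, Finset.mul_sum]
    refine sum_mem fun k _ => ?_
    obtain ⟨c, hc⟩ := hA' t k.2
    rw [hc, pdPow_smul, ← map_pow, mul_comm (algebraMap A _ _), ← mul_assoc, ← mul_assoc]
    exact halg _ _ (halg _ _ (hmulE _ _ hz))

omit [Fact p.Prime] in
/-- A linear relation between the elements `E ^ n / n!` of the fraction field holds in the divided
power envelope. -/
theorem PDEnv.sum_pdPow_eq_zero (E : pdIdeal p J) (hE0 : (E : A) ≠ 0)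
    (hE : ∀ (n : ℕ) (a : A), n ≠ 0 → (E : A) ∣ n * a → (E : A) ∣ a) (L : ℕ) :
    ∀ (m : ℕ) (a : ℕ → A),
      pdToFractionRing p J
        (∑ i ∈ Finset.range L, algebraMap A _ (a i) * pdPow p J (m + i) E) = 0 →
      ∑ i ∈ Finset.range L, algebraMap A (PDEnv p J) (a i) * pdPow p J (m + i) E = 0 := by
  have hinj : Function.Injective (algebraMap A (FractionRing A)) :=
    IsFractionRing.injective A (FractionRing A)
  have he : algebraMap A (FractionRing A) E ≠ 0 := fun h => hE0 (hinj (by rw [h, map_zero]))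
  have hfac : ∀ n : ℕ, (n.factorial : FractionRing A) ≠ 0 :=
    fun n => Nat.cast_ne_zero.2 n.factorial_ne_zero
  induction L with
  | zero => intro m a _; simp
  | succ L ih =>
    intro m a h
    cases L with
    | zero =>
      simp only [zero_add, Finset.range_one, Finset.sum_singleton, add_zero, map_mul,
        pdToFractionRing_algebraMap, pdToFractionRing_pdPow] at h ⊢
      rcases mul_eq_zero.1 h with h | h
      · rw [hinj (h.trans (map_zero _).symm), map_zero, zero_mul]
      · exact ((div_ne_zero (pow_ne_zero m he) (hfac m)) h).elim
    | succ L =>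
      -- the coefficient `a 0` is divisible by `E`
      have hdvd : (E : A) ∣ a 0 := by
        -- Multiplying the relation by `M / E ^ m` clears all denominators. Every term except the
        -- first then carries a factor `E`, so `E` divides `(M / m!) a 0`.
        let M := (m + (L + 1)).factorial
        have hM : ∀ i, i ≤ L + 1 → ((M / (m + i).factorial : ℕ) : FractionRing A) =
            M / (m + i).factorial := fun i hi =>
          Nat.cast_div (Nat.factorial_dvd_factorial (by omega)) (hfac _)
        refine hE (M / m.factorial) (a 0) (Nat.div_ne_zero_iff_of_dvd
          (Nat.factorial_dvd_factorial (by omega)) |>.2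
            ⟨Nat.factorial_ne_zero _, Nat.factorial_ne_zero _⟩) ?_
        refine ⟨-∑ i ∈ Finset.range (L + 1),
          (M / (m + (i + 1)).factorial : ℕ) * a (i + 1) * (E : A) ^ i, hinj ?_⟩
        rw [Finset.sum_range_succ'] at h
        simp only [map_add, map_sum, map_mul, pdToFractionRing_algebraMap,
          pdToFractionRing_pdPow, add_zero] at h
        simp only [map_mul, map_neg, map_sum, map_natCast, map_pow]
        have hM0 := hM 0 (by omega)
        rw [add_zero] at hM0
        rw [hM0]
        have h1 : algebraMap A (FractionRing A) E * -∑ i ∈ Finset.range (L + 1),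
            ((M / (m + (i + 1)).factorial : ℕ) : FractionRing A) *
              algebraMap A (FractionRing A) (a (i + 1)) * algebraMap A (FractionRing A) E ^ i =
            -(M / algebraMap A (FractionRing A) E ^ m * ∑ i ∈ Finset.range (L + 1),
              algebraMap A (FractionRing A) (a (i + 1)) *
                (algebraMap A (FractionRing A) E ^ (m + (i + 1)) /
                  ((m + (i + 1)).factorial : FractionRing A))) := by
          rw [mul_neg, Finset.mul_sum, Finset.mul_sum]
          congr 1
          refine Finset.sum_congr rfl fun i hi => ?_
          rw [hM (i + 1) (by have := Finset.mem_range.1 hi; omega), pow_add _ m]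
          have := pow_ne_zero m he
          have := hfac (m + (i + 1))
          field_simp
          ring
        rw [h1, eq_neg_of_add_eq_zero_left h]
        have := pow_ne_zero m he
        have := hfac m
        field_simp
      obtain ⟨b, hb⟩ := hdvd
      -- With `a 0 = E b`, the first term becomes `(m + 1) b E^{[m+1]}`. It is absorbed into the
      -- next coefficient, and the relation gets shorter by one.
      let a' : ℕ → A := fun i => if i = 0 then a 1 + (m + 1 : ℕ) * b else a (i + 1)
      have hsum : ∑ i ∈ Finset.range (L + 1 + 1), algebraMap A (PDEnv p J) (a i) *
          pdPow p J (m + i) E =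
          ∑ i ∈ Finset.range (L + 1), algebraMap A (PDEnv p J) (a' i) *
            pdPow p J (m + 1 + i) E := by
        rw [Finset.sum_range_succ', Finset.sum_range_succ', Finset.sum_range_succ' _ L, add_assoc]
        congr 1
        · refine Finset.sum_congr rfl fun i _ => ?_
          simp only [a', Nat.succ_ne_zero, if_false]
          rw [show m + 1 + (i + 1) = m + (i + 1 + 1) by ring]
        · have h2 := pdPow_succ_nsmul p J m E
          simp only [a', if_true, hb, map_mul, map_add, map_natCast, add_zero, zero_add]
          push_cast
          linear_combination algebraMap A (PDEnv p J) b * h2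
      rw [hsum] at h ⊢
      exact ih (m + 1) a' h

/-- The image of `z` in the fraction field vanishes, since `p` is invertible there. As `z` is a
combination of divided powers of `E`, whose relations are detected in that field, `z` vanishes too.
-/
theorem PDEnv.eq_zero_of_p_mul_eq_zero (hA : ∀ m : ℕ, ¬ p ∣ m → IsUnit (m : A))
    (E : A) (hJ : J = Ideal.span {E}) (hE0 : E ≠ 0)
    (hE : ∀ (n : ℕ) (a : A), n ≠ 0 → E ∣ n * a → E ∣ a) (z : PDEnv p J)
    (hz : (p : PDEnv p J) * z = 0) : z = 0 := by
  let E' : pdIdeal p J := ⟨E, Ideal.mem_sup_left (hJ ▸ Ideal.mem_span_singleton_self E)⟩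
  have hspan := PDEnv.mem_span_pdPow hA E' hJ z
  obtain ⟨c, hc⟩ := (Finsupp.mem_span_range_iff_exists_finsupp).1 hspan
  have hz' : ∃ L, z = ∑ i ∈ Finset.range L, algebraMap A (PDEnv p J) (c i) *
      pdPow p J (0 + i) E' := by
    refine ⟨c.support.sup id + 1, ?_⟩
    rw [← hc, Finsupp.sum_of_support_subset (s := Finset.range (c.support.sup id + 1))]
    · simp only [Algebra.smul_def, zero_add]
    · intro i hi
      exact Finset.mem_range.2 (Nat.lt_succ_of_le (Finset.le_sup (f := id) hi))
    · simp
  obtain ⟨L, hL⟩ := hz'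
  have h0 : pdToFractionRing p J z = 0 := by
    have h := congrArg (pdToFractionRing p J) hz
    rw [map_mul, map_natCast, map_zero] at h
    exact (mul_eq_zero.1 h).resolve_left (Nat.cast_ne_zero.2 (Nat.Prime.ne_zero Fact.out))
  rw [hL] at h0 ⊢
  exact PDEnv.sum_pdPow_eq_zero E' hE0 hE L 0 c h0

end TorsionFree

/-! ### p-adic completions -/

section Completeness

/-- A quotient of a complete Noetherian local ring is complete. -/
theorem isAdicComplete_quotient {R : Type u} [CommRing R] [IsNoetherianRing R] [IsLocalRing R]
    [IsAdicComplete (maximalIdeal R) R] (𝔞 : Ideal R) :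
    IsAdicComplete ((maximalIdeal R).map (Ideal.Quotient.mk 𝔞)) (R ⧸ 𝔞) := by
  change IsAdicComplete ((maximalIdeal R).map (algebraMap R (R ⧸ 𝔞))) (R ⧸ 𝔞)
  rw [IsAdicComplete.map_algebraMap_iff]
  -- Completion preserves surjections, so precompleteness passes to the quotient.
  have hpre : IsPrecomplete (maximalIdeal R) (R ⧸ 𝔞) := by
    rw [← AdicCompletion.of_surjective_iff]
    intro y
    obtain ⟨x, rfl⟩ := AdicCompletion.map_surjective (maximalIdeal R) (f := 𝔞.mkQ)
      (Submodule.mkQ_surjective 𝔞) y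
    obtain ⟨r, rfl⟩ := AdicCompletion.of_surjective (maximalIdeal R) R x
    exact ⟨𝔞.mkQ r, (AdicCompletion.map_of (maximalIdeal R) 𝔞.mkQ r).symm⟩
  exact { }

variable {p : ℕ} {D : Type u} [CommRing D]

instance isAdicComplete_PCompl :
    IsAdicComplete (Ideal.span {(p : PCompl p D)}) (PCompl p D) := by
  have h : Ideal.span {(p : PCompl p D)} =
      (Ideal.span {(p : D)}).map (algebraMap D (PCompl p D)) := by
    rw [Ideal.map_span, Set.image_singleton, map_natCast]
  rw [h, IsAdicComplete.map_algebraMap_iff]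
  exact AdicCompletion.isAdicComplete ⟨{(p : D)}, by simp⟩

/-- The kernel of evaluation at level `n` is `p ^ n` times the completion, because `(p)` is finitely
generated. This is how questions about the completion are reduced to `D`. -/
theorem PCompl.exists_eq_add (n : ℕ) (s : PCompl p D) :
    ∃ (z : D) (t : PCompl p D), s = algebraMap D (PCompl p D) z + (p : PCompl p D) ^ n * t := by
  obtain ⟨z, hz⟩ := Submodule.Quotient.mk_surjective _ (AdicCompletion.eval _ D n s)
  have h : s - algebraMap D (PCompl p D) z ∈
      (AdicCompletion.eval (Ideal.span {(p : D)}) D n).ker := by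
    rw [LinearMap.mem_ker, map_sub, ← hz, sub_eq_zero]
    rfl
  rw [← AdicCompletion.pow_smul_top_eq_ker_eval ⟨{(p : D)}, by simp⟩, Ideal.span_singleton_pow,
    Submodule.ideal_span_singleton_smul] at h
  obtain ⟨t, -, ht⟩ := h
  refine ⟨z, t, ?_⟩
  rw [← sub_eq_iff_eq_add', ← ht]
  change (p : D) ^ n • t = _
  rw [Algebra.smul_def, map_pow, map_natCast]

theorem PCompl.dvd_of_algebraMap_eq {n : ℕ} {z : D} {t : PCompl p D}
    (h : algebraMap D (PCompl p D) z = (p : PCompl p D) ^ n * t) : (p : D) ^ n ∣ z := by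
  have h1 : AdicCompletion.of (Ideal.span {(p : D)}) D z ∈
      (AdicCompletion.eval (Ideal.span {(p : D)}) D n).ker := by
    rw [← AdicCompletion.pow_smul_top_eq_ker_eval ⟨{(p : D)}, by simp⟩, Ideal.span_singleton_pow,
      Submodule.ideal_span_singleton_smul]
    refine ⟨t, trivial, ?_⟩
    change (p : D) ^ n • t = algebraMap D (PCompl p D) z
    rw [h, Algebra.smul_def, map_pow, map_natCast]
  rw [LinearMap.mem_ker, AdicCompletion.eval_of, Submodule.mkQ_apply,
    Submodule.Quotient.mk_eq_zero, Ideal.span_singleton_pow, smul_eq_mul, Ideal.mul_top,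
    Ideal.mem_span_singleton] at h1
  exact h1

theorem PCompl.eq_zero_of_forall_dvd {s : PCompl p D} (h : ∀ n, (p : PCompl p D) ^ n ∣ s) :
    s = 0 := by
  refine IsHausdorff.haus (I := Ideal.span {(p : PCompl p D)}) inferInstance s fun n => ?_
  rw [SModEq.zero, smul_eq_mul, Ideal.mul_top, Ideal.span_singleton_pow,
    Ideal.mem_span_singleton]
  exact h n

/-- Write `s = z + p ^ n t`. Then `p z` is divisible by `p ^ (n+1)`, already in `D`, so `p ^ n`
divides `z` and hence `s`. As `n` is arbitrary, `s = 0`. -/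
theorem PCompl.eq_zero_of_p_mul_eq_zero (hD : ∀ z : D, (p : D) * z = 0 → z = 0) (s : PCompl p D)
    (hs : (p : PCompl p D) * s = 0) : s = 0 := by
  refine PCompl.eq_zero_of_forall_dvd fun n => ?_
  obtain ⟨z, t, rfl⟩ := PCompl.exists_eq_add n s
  have h : algebraMap D (PCompl p D) (p * z) = (p : PCompl p D) ^ (n + 1) * -t := by
    rw [map_mul, map_natCast]
    linear_combination hs
  obtain ⟨c, hc⟩ := PCompl.dvd_of_algebraMap_eq h
  have h2 : z = (p : D) ^ n * c := by
    rw [← sub_eq_zero]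
    refine hD _ ?_
    linear_combination hc
  rw [h2, map_mul, map_pow, map_natCast, ← mul_add]
  exact dvd_mul_right _ _

/-- An additive map from a `p`-adic completion to a finite free module over it is determined by
its values on the original ring. -/
theorem PCompl.addHom_ext {X : Type v} [AddCommGroup X] [Module (PCompl p D) X]
    [Module.Free (PCompl p D) X] {f g : PCompl p D →+ X}
    (h : ∀ z, f (algebraMap D (PCompl p D) z) = g (algebraMap D (PCompl p D) z)) : f = g := by
  ext s
  rw [← sub_eq_zero]
  refine (Module.Free.chooseBasis (PCompl p D) X).ext_elem fun i => ?_
  rw [map_zero, Finsupp.zero_apply]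
  refine PCompl.eq_zero_of_forall_dvd fun n => ?_
  obtain ⟨z, t, rfl⟩ := PCompl.exists_eq_add n s
  have hsmul : ∀ F : PCompl p D →+ X, F ((p : PCompl p D) ^ n * t) =
      (p : PCompl p D) ^ n • F t := by
    intro F
    rw [← Nat.cast_pow, ← nsmul_eq_mul, map_nsmul, Nat.cast_smul_eq_nsmul]
  rw [map_add, map_add, h, add_sub_add_left_eq_sub, hsmul, hsmul, ← smul_sub, map_smul,
    Finsupp.smul_apply, smul_eq_mul]
  exact dvd_mul_right _ _

theorem complRingHom_algebraMap {B : Type v} [CommRing B] (f : D →+* B) (z : D) :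
    complRingHom p f (algebraMap D (PCompl p D) z) = algebraMap B (PCompl p B) (f z) :=
  complRingHom_of p f z

theorem complAddHom_algebraMap (f : D →+ D) (z : D) :
    complAddHom p f (algebraMap D (PCompl p D) z) = algebraMap D (PCompl p D) (f z) :=
  complAddHom_of p f z

/-- Both sides are additive in each variable, so the Leibniz rule extends from `D` one variable at a
time. -/
theorem complAddHom_mul {f : D →+ D} (hf : ∀ z w, f (z * w) = z * f w + w * f z)
    (s t : PCompl p D) :
    complAddHom p f (s * t) = s * complAddHom p f t + t * complAddHom p f s := by
  let F := complAddHom p f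
  have key : ∀ (G H : PCompl p D →+ PCompl p D), (∀ z, G (algebraMap D (PCompl p D) z) =
      H (algebraMap D (PCompl p D) z)) → ∀ s, G s = H s :=
    fun G H h s => DFunLike.congr_fun (PCompl.addHom_ext h) s
  have h1 : ∀ (z : D) (t : PCompl p D), F (algebraMap D (PCompl p D) z * t) =
      algebraMap D (PCompl p D) z * F t + t * F (algebraMap D (PCompl p D) z) := by
    intro z
    refine key (F.comp (AddMonoidHom.mulLeft (algebraMap D (PCompl p D) z)))
      ((AddMonoidHom.mulLeft (algebraMap D (PCompl p D) z)).comp F +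
        AddMonoidHom.mulRight (F (algebraMap D (PCompl p D) z))) fun w => ?_
    change F (algebraMap D (PCompl p D) z * algebraMap D (PCompl p D) w) =
      algebraMap D (PCompl p D) z * F (algebraMap D (PCompl p D) w) +
        algebraMap D (PCompl p D) w * F (algebraMap D (PCompl p D) z)
    simp only [F, ← map_mul, complAddHom_algebraMap, ← map_add, hf]
  exact key (F.comp (AddMonoidHom.mulRight t))
    (AddMonoidHom.mulRight (F t) + (AddMonoidHom.mulLeft t).comp F) (fun z => h1 z t) s

end Completeness

/-! ### The Leibniz rule on the envelope -/

section Derivation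

variable {p : ℕ} {A : Type u} [CommRing A] {J : Ideal A} {K : Type w} [CommRing K] [Algebra K A]
  (δ : Derivation K A A)
  (hδ : ∀ (n : ℕ) (c : A), (n.factorial : A) * c = (p : A) ^ n → δ c = 0)

theorem fst_pdDerHom (z : PDEnv p J) : (pdDerHom p J δ hδ z).fst = z := by
  induction z using PDEnv.induction with
  | h_alg a => rw [pdDerHom, pdLift_algebraMap, fst_derHom]
  | h_sum z w hz hw => rw [map_add, TrivSqZeroExt.fst_add, hz, hw]
  | h_mul z n x hz =>
    rw [map_mul, TrivSqZeroExt.fst_mul, hz, pdDerHom, pdLift_pdPow, fst_pdDerAux]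

theorem pdDer_mul (z w : PDEnv p J) :
    pdDer p J δ hδ (z * w) = z * pdDer p J δ hδ w + w * pdDer p J δ hδ z := by
  change (pdDerHom p J δ hδ (z * w)).snd = _
  rw [map_mul, TrivSqZeroExt.snd_mul, fst_pdDerHom, fst_pdDerHom, smul_eq_mul,
    MulOpposite.smul_eq_mul_unop, MulOpposite.unop_op, mul_comm _ w]
  rfl

end Derivation

/-! ### The connection and the Frobenius on S -/

section Connection

variable {p : ℕ} [Fact p.Prime] {k : Type u} [Field k] [CharP k p] {d : ℕ}
  (J : Ideal (PS p k d))

omit [CharP k p] in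
theorem algebraMap_BS (a : PS p k d) : algebraMap (PS p k d) (BS J) a =
    algebraMap (PDEnv p J) (BS J) (algebraMap (PS p k d) (PDEnv p J) a) :=
  rfl

theorem nablaS_apply (s : BS J) : nablaS J s = ∑ i : Fin d,
    complAddHom p (pdDer p J (partialDer p k d i) (partialDer_pow_div_factorial p k d i)) s ⊗ₜ
      Pi.single i 1 := by
  simp [nablaS]

theorem nablaS_mul (s t : BS J) : nablaS J (s * t) = s • nablaS J t + t • nablaS J s := by
  simp only [nablaS_apply, Finset.smul_sum, TensorProduct.smul_tmul', smul_eq_mul,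
    ← Finset.sum_add_distrib, ← TensorProduct.add_tmul]
  refine Finset.sum_congr rfl fun i _ => ?_
  rw [complAddHom_mul (pdDer_mul _ _)]

omit [CharP k p] in
theorem sum_tmul_single (s : BS J) (ω : Omega p k d) :
    ∑ i : Fin d, (s * algebraMap (PS p k d) (BS J) (ω i)) ⊗ₜ[PS p k d]
      (Pi.single i 1 : Omega p k d) = s ⊗ₜ ω := by
  conv_rhs => rw [← Finset.univ_sum_single ω]
  rw [TensorProduct.tmul_sum]
  refine Finset.sum_congr rfl fun i _ => ?_
  rw [mul_comm, ← Algebra.smul_def, TensorProduct.smul_tmul, ← Pi.single_smul, smul_eq_mul,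
    mul_one]

theorem nablaS_algebraMap (a : PS p k d) :
    nablaS J (algebraMap (PS p k d) (BS J) a) = 1 ⊗ₜ univD p k d a := by
  rw [nablaS_apply, ← sum_tmul_single]
  refine Finset.sum_congr rfl fun i _ => ?_
  rw [algebraMap_BS, complAddHom_algebraMap, pdDer_algebraMap, one_mul]
  rfl

theorem nablaS_pdPow (n : ℕ) (x : pdIdeal p J) :
    nablaS J (algebraMap (PDEnv p J) (BS J) (pdPow p J (n + 1) x)) =
      algebraMap (PDEnv p J) (BS J) (pdPow p J n x) ⊗ₜ univD p k d (x : PS p k d) := by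
  rw [nablaS_apply, ← sum_tmul_single]
  refine Finset.sum_congr rfl fun i _ => ?_
  rw [complAddHom_algebraMap, pdDer_pdPow, map_mul]
  rfl

variable {φ : PS p k d →+* PS p k d} (hφ : IsFrobeniusLift φ)

omit [CharP k p] in
theorem phiS_algebraMap_PDEnv (z : PDEnv p J) :
    phiS J φ hφ (algebraMap (PDEnv p J) (BS J) z) =
      algebraMap (PDEnv p J) (BS J) (pdPhi p J φ (hφ.map_pdIdeal J) z) :=
  complRingHom_algebraMap _ z

omit [CharP k p] in
theorem dPhiS_tmul (s : BS J) (ω : Omega p k d) :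
    dPhiS J φ hφ (s ⊗ₜ ω) = phiS J φ hφ s ⊗ₜ dPhi φ ω :=
  rfl

/-- The Frobenius of `S` is horizontal for `∇_S`. -/
theorem nablaS_phiS [PerfectRing k p] (s : BS J) :
    nablaS J (phiS J φ hφ s) = dPhiS J φ hφ (nablaS J s) := by
  have key : (nablaS J).comp (phiS J φ hφ).toAddMonoidHom =
      (dPhiS J φ hφ).toAddMonoidHom.comp (nablaS J) := by
    -- Both composites are additive, so it suffices to compare them on the envelope. There both obey
    -- the same twisted Leibniz rule, and on its generators the claim reduces to `d ∘ φ = dφ ∘ d` on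
    -- `𝔖`.
    refine PCompl.addHom_ext fun z => ?_
    change nablaS J (phiS J φ hφ (algebraMap (PDEnv p J) (BS J) z)) =
      dPhiS J φ hφ (nablaS J (algebraMap (PDEnv p J) (BS J) z))
    induction z using PDEnv.induction with
    | h_alg a =>
      rw [← algebraMap_BS, phiS_algebraMap, nablaS_algebraMap, nablaS_algebraMap, univD_map hφ,
        dPhiS_tmul, map_one]
    | h_sum z w hz hw => simp only [map_add, hz, hw]
    | h_mul z n x hz =>
      have hx : nablaS J (phiS J φ hφ (algebraMap (PDEnv p J) (BS J) (pdPow p J n x))) =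
          dPhiS J φ hφ (nablaS J (algebraMap (PDEnv p J) (BS J) (pdPow p J n x))) := by
        cases n with
        | zero =>
          have h1 : nablaS J (1 : BS J) = 0 := by
            have := nablaS_algebraMap J 1
            rwa [map_one, Derivation.map_one_eq_zero, TensorProduct.tmul_zero] at this
          rw [pdPow_zero, map_one, map_one, h1, map_zero]
        | succ n =>
          rw [phiS_algebraMap_PDEnv, pdPhi_pdPow, nablaS_pdPow, nablaS_pdPow, dPhiS_tmul,
            phiS_algebraMap_PDEnv, pdPhi_pdPow, univD_map hφ]
      simp only [map_mul, nablaS_mul, map_add, LinearMap.map_smulₛₗ, hz, hx]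
  exact DFunLike.congr_fun key s

/-- The map `φ ⊗ (dφ)_1` on `S ⊗_𝔖 Ω̂_𝔖`. -/
def dPhiOneS : OmegaS J →ₛₗ[phiS J φ hφ] OmegaS J where
  toFun := TensorProduct.map (σ₁₂ := φ)
    ({ toFun := phiS J φ hφ
       map_add' := map_add _
       map_smul' := fun a s => by
        rw [Algebra.smul_def, map_mul, phiS_algebraMap, Algebra.smul_def] } :
      BS J →ₛₗ[φ] BS J) (dPhiOne φ hφ)
  map_add' := map_add _
  map_smul' s t := by
    induction t using TensorProduct.induction_on with
    | zero => simp
    | add x y hx hy => simp only [smul_add, map_add, hx, hy]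
    | tmul x y =>
      rw [TensorProduct.smul_tmul', TensorProduct.map_tmul, TensorProduct.map_tmul,
        TensorProduct.smul_tmul']
      simp

omit [CharP k p] in
theorem dPhiOneS_tmul (s : BS J) (ω : Omega p k d) :
    dPhiOneS J hφ (s ⊗ₜ ω) = phiS J φ hφ s ⊗ₜ dPhiOne φ hφ ω :=
  rfl

omit [CharP k p] in
theorem dPhiS_eq_natCast_smul (x : OmegaS J) :
    dPhiS J φ hφ x = (p : BS J) • dPhiOneS J hφ x := by
  induction x using TensorProduct.induction_on with
  | zero => simp
  | add x y hx hy => simp only [map_add, smul_add, hx, hy]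
  | tmul s ω =>
    rw [dPhiS_tmul, dPhiOneS_tmul, ← p_smul_dPhiOne φ hφ, TensorProduct.tmul_smul,
      Nat.cast_smul_eq_nsmul, Nat.cast_smul_eq_nsmul]

omit [CharP k p] in
theorem iterate_dPhiOneS_mem {𝔞 : Ideal (BS J)}
    (h𝔞 : ∀ a ∈ RingHom.ker (toResidue p k d), algebraMap _ (BS J) a ∈ 𝔞) {n : ℕ}
    (hn : ∀ ω : Omega p k d, (dPhiOne φ hφ)^[n] ω ∈
      RingHom.ker (toResidue p k d) • (⊤ : Submodule (PS p k d) (Omega p k d)))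
    (x : OmegaS J) :
    (dPhiOneS J hφ)^[n] x ∈ 𝔞 • (⊤ : Submodule (BS J) (OmegaS J)) := by
  induction x using TensorProduct.induction_on with
  | zero => rw [iterate_map_zero]; exact zero_mem _
  | add x y hx hy => rw [iterate_map_add]; exact add_mem hx hy
  | tmul s ω =>
    have h : ∀ m, (dPhiOneS J hφ)^[m] (s ⊗ₜ ω) =
        (phiS J φ hφ)^[m] s ⊗ₜ (dPhiOne φ hφ)^[m] ω := by
      intro m
      induction m with
      | zero => rfl
      | succ m ih => rw [Function.iterate_succ_apply', ih, dPhiOneS_tmul,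
          ← Function.iterate_succ_apply' (phiS J φ hφ),
          ← Function.iterate_succ_apply' (dPhiOne φ hφ)]
    rw [h n]
    have hmem : ∀ (t : BS J) (η : Omega p k d), η ∈ RingHom.ker (toResidue p k d) •
        (⊤ : Submodule (PS p k d) (Omega p k d)) →
        t ⊗ₜ η ∈ 𝔞 • (⊤ : Submodule (BS J) (OmegaS J)) := by
      intro t η hη
      induction hη using Submodule.smul_induction_on' with
      | smul a ha η _ =>
        rw [← TensorProduct.smul_tmul, Algebra.smul_def, ← smul_eq_mul, ← TensorProduct.smul_tmul']
        exact Submodule.smul_mem_smul (h𝔞 a ha) trivial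
      | add η _ η' _ h h' => rw [TensorProduct.tmul_add]; exact add_mem h h'
    exact hmem _ _ (hn ω)

end Connection

/-! ### The Breuil frame is contracting -/

section Frame

variable {p : ℕ} [Fact p.Prime] {R : Type u} [CommRing R] [IsDomain R] [CharZero R]
  [IsLocalRing R] [CharP (ResidueField R) p]

omit [IsDomain R] [CharZero R] [Fact p.Prime] in
theorem isUnit_natCast_of_not_dvd (m : ℕ) (hm : ¬ p ∣ m) : IsUnit (m : R) := by
  rw [← IsLocalRing.notMem_maximalIdeal, ← IsLocalRing.residue_eq_zero_iff, map_natCast,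
    CharP.cast_eq_zero_iff (ResidueField R) p]
  exact hm

omit [IsDomain R] [CharZero R] [Fact p.Prime] in
theorem natCast_mem_maximalIdeal : (p : R) ∈ maximalIdeal R := by
  rw [← IsLocalRing.residue_eq_zero_iff, map_natCast, CharP.cast_eq_zero]

theorem isUnit_natCast_PS {k : Type u} [Field k] [CharP k p] [PerfectRing k p] {d : ℕ} (m : ℕ)
    (hm : ¬ p ∣ m) : IsUnit (m : PS p k d) := by
  rw [← IsLocalRing.notMem_maximalIdeal, maximalIdeal_PS, RingHom.mem_ker, map_natCast,
    CharP.cast_eq_zero_iff k p]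
  exact hm

/-- Since `π(x)` is a multiple of `p`, this comes down to `p ^ n / n!` being divisible by `p`. -/
theorem p_dvd_pdToR_pdPow {A : Type v} [CommRing A] (π : A →+* R) {n : ℕ} (hn : n ≠ 0)
    (x : pdIdeal p (RingHom.ker π)) : (p : R) ∣ pdToR p π (pdPow p (RingHom.ker π) n x) := by
  obtain ⟨y, hy, z, hz, hyz⟩ := Submodule.mem_sup.1 x.2
  obtain ⟨t, rfl⟩ := Ideal.mem_span_singleton.1 hz
  obtain ⟨c, hc⟩ := exists_factorial_mul_p_mul_eq p (A := R) isUnit_natCast_of_not_dvd hn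
  refine ⟨c * π t ^ n, ?_⟩
  rw [pdToR, pdLift_pdPow]
  refine factorial_mul_cancel (n := n) ?_
  rw [factorial_mul_mapDivPow, ← hyz, map_add, RingHom.mem_ker.1 hy, zero_add, map_mul,
    map_natCast, mul_pow, ← hc]
  ring

theorem pdToR_algebraMap {A : Type v} [CommRing A] (π : A →+* R) (a : A) :
    pdToR p π (algebraMap A _ a) = π a := by
  rw [pdToR, pdLift_algebraMap]

variable {d : ℕ} (π : PS p (ResidueField R) d →+* R)

/-- The natural map `S → R / pR`. -/
def toRModP : BS (RingHom.ker π) →+* R ⧸ Ideal.span {(p : R)} ^ 1 :=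
  complRingHomAux p (pdToR p π) 1

theorem toRModP_algebraMap (z : PDEnv p (RingHom.ker π)) :
    toRModP π (algebraMap _ (BS (RingHom.ker π)) z) = Ideal.Quotient.mk _ (pdToR p π z) := by
  rw [toRModP, complRingHomAux, RingHom.comp_apply]
  change Ideal.quotientMap _ _ _ (AdicCompletion.evalₐ
    (Ideal.span {(p : PDEnv p (RingHom.ker π))}) 1
    (AdicCompletion.of (Ideal.span {(p : PDEnv p (RingHom.ker π))}) _ z)) = _
  rw [AdicCompletion.evalₐ_of]
  exact Ideal.quotientMap_mk

omit [IsDomain R] [CharZero R] [IsLocalRing R] [CharP (ResidueField R) p] [Fact p.Prime] in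
theorem natCast_quotient_eq_zero : (p : R ⧸ Ideal.span {(p : R)} ^ 1) = 0 := by
  rw [← map_natCast (Ideal.Quotient.mk _), Ideal.Quotient.eq_zero_iff_mem, pow_one]
  exact Ideal.mem_span_singleton_self _

theorem toRModP_surjective (hπ : Function.Surjective π) : Function.Surjective (toRModP π) := by
  intro r
  obtain ⟨r, rfl⟩ := Ideal.Quotient.mk_surjective r
  obtain ⟨a, rfl⟩ := hπ r
  exact ⟨_, (toRModP_algebraMap π (algebraMap _ _ a)).trans (by rw [pdToR_algebraMap])⟩

variable {φ : PS p (ResidueField R) d →+* PS p (ResidueField R) d} (hφ : IsFrobeniusLift φ)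
variable [PerfectRing (ResidueField R) p]

omit [IsDomain R] [CharZero R] in
/-- The endomorphism `φ` of `S` is a lift of Frobenius. -/
theorem p_dvd_phiS_sub_pow (J : Ideal (PS p (ResidueField R) d)) (s : BS J) :
    (p : BS J) ∣ phiS J φ hφ s - s ^ p := by
  obtain ⟨z, t, rfl⟩ := PCompl.exists_eq_add 1 s
  rw [pow_one]
  obtain ⟨c, hc⟩ := p_dvd_pdPhi_sub_pow isUnit_natCast_PS hφ (hφ.map_pdIdeal J) z
  have h1 : (p : BS J) ∣ (algebraMap (PDEnv p J) (BS J) z + p * t) ^ p -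
      algebraMap (PDEnv p J) (BS J) z ^ p := by
    refine dvd_trans ?_ (sub_dvd_pow_sub_pow _ _ p)
    rw [add_sub_cancel_left]
    exact dvd_mul_right _ _
  have h2 : phiS J φ hφ (algebraMap (PDEnv p J) (BS J) z) -
      algebraMap (PDEnv p J) (BS J) z ^ p = p * algebraMap (PDEnv p J) (BS J) c := by
    rw [phiS_algebraMap_PDEnv, ← map_pow, ← map_sub, hc, map_mul, map_natCast]
  have h3 : phiS J φ hφ (algebraMap (PDEnv p J) (BS J) z + p * t) -
      (algebraMap (PDEnv p J) (BS J) z + p * t) ^ p =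
      p * algebraMap (PDEnv p J) (BS J) c + p * phiS J φ hφ t -
      ((algebraMap (PDEnv p J) (BS J) z + p * t) ^ p -
        algebraMap (PDEnv p J) (BS J) z ^ p) := by
    rw [← h2, map_add, map_mul, map_natCast]
    ring
  rw [h3]
  exact dvd_sub (dvd_add (dvd_mul_right _ _) (dvd_mul_right _ _)) h1

theorem toRModP_phiS (s : BS (RingHom.ker π)) :
    toRModP π (phiS _ φ hφ s) = toRModP π s ^ p := by
  obtain ⟨c, hc⟩ := p_dvd_phiS_sub_pow hφ (RingHom.ker π) s
  rw [sub_eq_iff_eq_add] at hc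
  rw [hc, map_add, map_mul, map_natCast, natCast_quotient_eq_zero, zero_mul, zero_add, map_pow]

/-- Modulo elements whose images under both `φ` and the map to `R` are divisible by `p`, an element
of the envelope comes from some `a` in `𝔖`. Vanishing in `R/p` puts `a` in `ker π + p𝔖`, and
elements of `ker π` are their own first divided powers, so `φ` makes them divisible by `p`. -/
theorem exists_phiS_eq_p_mul (hπ : Function.Surjective π) (s : BS (RingHom.ker π))
    (hs : toRModP π s = 0) : ∃ t, phiS _ φ hφ s = p * t := by
  obtain ⟨z, t, rfl⟩ := PCompl.exists_eq_add 1 s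
  rw [pow_one (p : BS (RingHom.ker π)), map_add, map_mul, map_natCast, natCast_quotient_eq_zero,
    zero_mul, add_zero, toRModP_algebraMap, Ideal.Quotient.eq_zero_iff_mem, pow_one] at hs
  let D := PDEnv p (RingHom.ker π)
  let φD : D →+* D := pdPhi p (RingHom.ker π) φ (hφ.map_pdIdeal _)
  let I₁ : Ideal D := (Ideal.span {(p : D)}).comap φD
  let I₂ : Ideal D := (Ideal.span {(p : R)}).comap (pdToR p π)
  have hI₁ : ∀ n ≠ 0, ∀ x, pdPow p (RingHom.ker π) n x ∈ I₁ := fun n hn x =>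
    Ideal.mem_span_singleton.2 (p_dvd_pdPhi_pdPow isUnit_natCast_PS hφ _ n hn x)
  have hp₁ : (p : D) ∈ I₁ := by
    rw [Ideal.mem_comap, map_natCast]
    exact Ideal.mem_span_singleton_self _
  obtain ⟨a, ha⟩ := PDEnv.exists_eq_algebraMap_add (I := I₁ ⊓ I₂) (fun n hn x =>
    ⟨hI₁ n hn x, Ideal.mem_span_singleton.2 (p_dvd_pdToR_pdPow π hn x)⟩) z
  have ha' : π a ∈ Ideal.span {(p : R)} := by
    have h1 : pdToR p π (z - algebraMap _ _ a) ∈ Ideal.span {(p : R)} := ha.2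
    rw [map_sub, pdToR_algebraMap] at h1
    simpa using sub_mem hs h1
  obtain ⟨r, hr⟩ := Ideal.mem_span_singleton.1 ha'
  obtain ⟨b, rfl⟩ := hπ r
  have hab : a - p * b ∈ RingHom.ker π := by
    rw [RingHom.mem_ker, map_sub, map_mul, map_natCast, hr, sub_self]
  have h2 : algebraMap _ D (a - p * b) ∈ I₁ := by
    have := hI₁ 1 one_ne_zero ⟨a - p * b, Ideal.mem_sup_left hab⟩
    rwa [pdPow_one] at this
  have h3 : z ∈ I₁ := by
    have h4 : z = (z - algebraMap _ D a) + algebraMap _ D (a - p * b) +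
        p * algebraMap _ D b := by
      rw [map_sub, map_mul, map_natCast]
      ring
    rw [h4]
    exact add_mem (add_mem ha.1 h2) (Ideal.mul_mem_right _ _ hp₁)
  obtain ⟨c, hc⟩ := Ideal.mem_span_singleton.1 h3
  refine ⟨algebraMap _ _ c + phiS _ φ hφ t, ?_⟩
  have hc' : pdPhi p (RingHom.ker π) φ (hφ.map_pdIdeal _) z = p * c := hc
  rw [pow_one (p : BS (RingHom.ker π)), map_add, map_mul, map_natCast, phiS_algebraMap_PDEnv,
    hc', map_mul, map_natCast, mul_add]

-- Units lift along `S → R/p`: an element `x` of the kernel has `φ(x)` in `pS` and `φ(x) ≡ x ^ p`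
-- modulo `p`, so `x ^ p` lies in `pS`. Thus `1 - x ^ p` is a unit by completeness, and so is its
-- divisor `1 - x`.
include hφ in
theorem isLocalRing_BS (hπ : Function.Surjective π) : IsLocalRing (BS (RingHom.ker π)) := by
  have hnt : Nontrivial (R ⧸ Ideal.span {(p : R)} ^ 1) := by
    rw [pow_one, Ideal.Quotient.nontrivial_iff, Ne, Ideal.span_singleton_eq_top]
    exact natCast_mem_maximalIdeal
  have : IsLocalRing (R ⧸ Ideal.span {(p : R)} ^ 1) :=
    IsLocalRing.of_surjective' (Ideal.Quotient.mk _) Ideal.Quotient.mk_surjective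
  have hjac : ∀ c : BS (RingHom.ker π), IsUnit (1 + p * c) := by
    intro c
    have h := IsAdicComplete.le_jacobson_bot (Ideal.span {(p : BS (RingHom.ker π))})
      (Ideal.mem_span_singleton_self _)
    rw [add_comm]
    exact Ideal.mem_jacobson_bot.1 h c
  have hloc : IsLocalHom (toRModP π) := by
    refine ⟨fun s hs => ?_⟩
    obtain ⟨r, hr⟩ := hs.exists_right_inv
    obtain ⟨s', rfl⟩ := toRModP_surjective π hπ r
    have hker : toRModP π (1 - s * s') = 0 := by rw [map_sub, map_mul, hr, map_one, sub_self]
    obtain ⟨t, ht⟩ := exists_phiS_eq_p_mul π hφ hπ _ hker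
    obtain ⟨c, hc⟩ := p_dvd_phiS_sub_pow hφ (RingHom.ker π) (1 - s * s')
    have h1 : s * s' ∣ 1 + p * (c - t) := by
      have h2 := sub_dvd_pow_sub_pow 1 (1 - s * s') p
      rw [one_pow, sub_sub_cancel] at h2
      have h3 : 1 - (1 - s * s') ^ p = 1 + p * (c - t) := by
        rw [ht] at hc
        linear_combination hc
      rwa [h3] at h2
    exact isUnit_of_mul_isUnit_left (isUnit_of_dvd_unit h1 (hjac _))
  exact RingHom.domain_isLocalRing (toRModP π)

omit [IsDomain R] [CharZero R] in
theorem map_mem_maximalIdeal (hπ : Function.Surjective π) (a : PS p (ResidueField R) d)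
    (ha : a ∈ RingHom.ker (toResidue p (ResidueField R) d)) : π a ∈ maximalIdeal R := by
  rw [← maximalIdeal_PS] at ha
  have hloc : IsLocalHom π := IsLocalHom.of_surjective π hπ
  exact fun hu => ha (isUnit_of_map_unit π a hu)

theorem BS_torsionFree (hd : ringKrullDim R = d) (hπ : Function.Surjective π)
    (hπu : Ideal.span (Set.range fun i => π (MvPowerSeries.X i)) = maximalIdeal R)
    (s : BS (RingHom.ker π)) (hs : (p : BS (RingHom.ker π)) * s = 0) : s = 0 := by
  refine PCompl.eq_zero_of_p_mul_eq_zero (fun z hz => ?_) s hs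
  obtain ⟨E, hE, hE0⟩ := exists_ker_eq_span hd π hπ hπu
  have : IsDomain (PS p (ResidueField R) d) := NoZeroDivisors.to_isDomain _
  have : CharZero (PS p (ResidueField R) d) := charZero_of_inj_zero fun n hn => by
    by_contra hn0
    exact one_ne_zero (PS.eq_zero_of_natCast_mul p (ResidueField R) d hn0 1 (by rw [hn, zero_mul]))
  -- Nonzero integers can be cancelled modulo `E` because `𝔖/(E)` embeds in `R`, a domain of
  -- characteristic zero.
  refine PDEnv.eq_zero_of_p_mul_eq_zero isUnit_natCast_PS E hE hE0 (fun n a hn h => ?_) z hz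
  have h1 : (n : PS p (ResidueField R) d) * a ∈ RingHom.ker π :=
    hE ▸ Ideal.mem_span_singleton.2 h
  rw [RingHom.mem_ker, map_mul, map_natCast] at h1
  have h2 : a ∈ RingHom.ker π := (mul_eq_zero.1 h1).resolve_left (Nat.cast_ne_zero.2 hn)
  rw [hE] at h2
  exact Ideal.mem_span_singleton.1 h2

theorem isContracting_frame (hd : ringKrullDim R = d) (hπ : Function.Surjective π)
    (hπu : Ideal.span (Set.range fun i => π (MvPowerSeries.X i)) = maximalIdeal R) :
    IsContracting p (frame π φ hφ) (toRModP π) where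
  ne_zero := Nat.Prime.ne_zero Fact.out
  ϖ_eq := rfl
  torsionFree := BS_torsionFree π hd hπ hπu
  surjective := toRModP_surjective π hπ
  φ_ker := exists_phiS_eq_p_mul π hφ hπ
  map_φ := toRModP_phiS π hφ

end Frame

end BreuilWindow

end

/-! ### The main theorem -/

theorem mainTheorem8 (p : ℕ) [Fact p.Prime] (hp : 3 ≤ p)
    (R : Type u) [CommRing R] [IsDomain R] [CharZero R] [IsRegularLocalRing R]
    [IsAdicComplete (maximalIdeal R) R] [CharP (ResidueField R) p]
    [PerfectRing (ResidueField R) p]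
    (d : ℕ) (hd : ringKrullDim R = d)
    (π : BreuilWindow.PS p (ResidueField R) d →+* R) (hπ : Function.Surjective π)
    (hπu : Ideal.span (Set.range fun i => π (MvPowerSeries.X i)) = maximalIdeal R)
    (φ : BreuilWindow.PS p (ResidueField R) d →+* BreuilWindow.PS p (ResidueField R) d)
    (hφ : BreuilWindow.IsFrobeniusLift φ) (hnil : BreuilWindow.DPhiOneNilpotent φ hφ) :
    (∀ M : BreuilWindow.Window.{u, w} (BreuilWindow.frame π φ hφ),
      ∃! nabla : M.M →+ M.M ⊗[BreuilWindow.BS (RingHom.ker π)]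
          BreuilWindow.OmegaS (RingHom.ker π),
        BreuilWindow.IsConnection (BreuilWindow.nablaS (RingHom.ker π)) M nabla ∧
        BreuilWindow.IsHorizontal (BreuilWindow.frameDPhi π φ hφ) M nabla) ∧
    (BreuilWindow.forgetConn.{u, u, w} (F := BreuilWindow.frame π φ hφ)
      (BreuilWindow.nablaS (RingHom.ker π))
      (BreuilWindow.frameDPhi π φ hφ)).IsEquivalence := by
  obtain ⟨n, hn⟩ := hnil
  have := BreuilWindow.isLocalRing_BS π hφ hπ
  -- The contraction takes place over `R/p`, which inherits completeness for its maximal ideal from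
  -- `R`.
  have := BreuilWindow.isAdicComplete_quotient (Ideal.span {(p : R)} ^ 1)
  let τ₁ : BreuilWindow.OmegaS (RingHom.ker π) →ₛₗ[(BreuilWindow.frame π φ hφ).φ]
    BreuilWindow.OmegaS (RingHom.ker π) := BreuilWindow.dPhiOneS (RingHom.ker π) hφ
  refine (BreuilWindow.isContracting_frame π hφ hd hπ hπu
    ).existsUnique_connection_and_isEquivalence
      ((maximalIdeal R).map (Ideal.Quotient.mk (Ideal.span {(p : R)} ^ 1))) (τ₁ := τ₁) (n := n)
      (BreuilWindow.dPhiS_eq_natCast_smul _ hφ) ?_ (BreuilWindow.nablaS_mul _)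
      (BreuilWindow.nablaS_phiS _ hφ)
  refine BreuilWindow.iterate_dPhiOneS_mem _ hφ (fun a ha => ?_) hn
  rw [Ideal.mem_comap, BreuilWindow.algebraMap_BS, BreuilWindow.toRModP_algebraMap,
    BreuilWindow.pdToR_algebraMap]
  exact Ideal.mem_map_of_mem _ (BreuilWindow.map_mem_maximalIdeal π hπ a ha)
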